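/- Let $n>k\ge 2$ be integers. **Trees.** A rooted tree on $n$ labelled leaves is a finite tree whose vertices of degree $1$ (the leaves) are labelled bijectively by $1,\dots,n$, with a distinguished root of degree at least $2$, all other non-leaves (the internal vertices) having degree at least $3$. Its combinatorial type is its class under label- and root-preserving isomorphisms. An internal edge is an edge not adjacent to a leaf; the outdegree of a vertex is the number of its children; a preleaf is a non-leaf all of whose children are leaves. The complex of $k$-equal trees $T_{n,k}$ is the abstract simplicial complex with maximal simplices the combinatorial types of rooted trees on $n$ labelled leaves in which every preleaf has outdegree $k$ and every other non-leaf has outdegree $2$, and lower dimensional simplices obtained from these by contracting internal edges. That is, the vertices of $T_{n,k}$ are the types with exactly one internal edge obtained from such trees by contraction, and the simplex given by a type $T$ has as its vertices the types with exactly one internal edge obtained from $T$ by contraction. **Lattice.** Let $\Pi_{n,k}$ be the lattice consisting of all joins (including the empty join), in the lattice of set partitions of $\{1,\dots,n\}$ with finer partitions smaller, of partitions with a single non-singleton block, of size $k$. An element $X>\hat 0$ of a finite lattice is irreducible if $[\hat 0,X]$ is not isomorphic to a product of two posets with more than one element each; $\mathcal I$ is the set of irreducible elements of $\Pi_{n,k}$.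 The reduced minimal nested set complex $\mathcal N(\Pi_{n,k},\mathcal I)$ has as simplices the non-empty sets $S\subseteq \mathcal I\setminus\{\hat 1\}$ such that the join of any at least two pairwise incomparable elements of $S$ does not belong to $\mathcal I$. The order complex $\Delta(\Pi_{n,k})$ has as simplices the non-empty chains in $\Pi_{n,k}\setminus\{\hat 0,\hat 1\}$. **Proposition.** 1. $T_{n,k}$ is well defined as an abstract simplicial complex: its simplices correspond bijectively, via the vertex sets described above, to the types with at least one internal edge that are obtained from the above maximal types by contracting internal edges; for these types together with the one without internal edges (which has empty vertex set), inclusion of vertex sets corresponds to contraction of internal edges. The maximal simplices are exactly those given by the above maximal types. 2. $T_{n,k}$ and $\mathcal N(\Pi_{n,k},\mathcal I)$ coincide as abstract simplicial complexes: there is an isomorphism between them which maps the simplex given by a tree $T$ to the nested set consisting, for all internal vertices $t$ of $T$, of the partitions whose only non-singleton block is the set of labels of leaves below $t$. 3. In particular, $\Delta(\Pi_{n,k})$ is obtained (up to isomorphism of abstract simplicial complexes) from $T_{n,k}$ by a finite sequence of stellar subdivisions. -/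

import Mathlib

namespace TreeComplex

/-! ## Abstract simplicial complexes -/

/-- The vertices of an abstract simplicial complex. -/
def vertices {V : Type*} (K : PreAbstractSimplicialComplex V) : Set V :=
  {v | {v} ∈ K.faces}

/-- An isomorphism of abstract simplicial complexes: a bijection of the vertex sets under which
the faces correspond to the faces. -/
structure ComplexIso {V W : Type*} (K : PreAbstractSimplicialComplex V)
    (L : PreAbstractSimplicialComplex W) where
  toEquiv : vertices K ≃ vertices L
  mem_faces_iff : ∀ s : Finset (vertices K),
    s.map (Function.Embedding.subtype _) ∈ K.faces ↔
      (s.map toEquiv.toEmbedding).map (Function.Embedding.subtype _) ∈ L.faces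

open Classical in
/-- The stellar subdivision of `K` in the simplex `σ`, with new vertex `v`: the simplices that
contain `σ` are removed, and for every (possibly empty) `ρ` which does not contain `σ` and for
which `ρ ∪ σ` is a simplex, the simplex `ρ ∪ {v}` is added. -/
def stellarSubdivision {V : Type*} (K : PreAbstractSimplicialComplex V) (σ : Finset V) (v : V) :
    PreAbstractSimplicialComplex V where
  faces := {τ | τ ∈ K.faces ∧ ¬ σ ⊆ τ} ∪
    {τ | ∃ ρ : Finset V, ρ ∪ σ ∈ K.faces ∧ ¬ σ ⊆ ρ ∧ τ = insert v ρ}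
  isRelLowerSet_faces := by
    rintro τ (⟨hτ, hστ⟩ | ⟨ρ, hρ, hσρ, rfl⟩)
    · exact ⟨(K.isRelLowerSet_faces hτ).1, fun t ht hne =>
        Or.inl ⟨(K.isRelLowerSet_faces hτ).2 ht hne, fun h => hστ (h.trans ht)⟩⟩
    · refine ⟨Finset.insert_nonempty _ _, fun t ht hne => ?_⟩
      have hσ : σ.Nonempty := by
        rcases σ.eq_empty_or_nonempty with h | h
        · exact absurd (h ▸ Finset.empty_subset ρ) hσρ
        · exact h
      by_cases hv : v ∈ t
      · have hsub : t.erase v ⊆ ρ := by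
          intro x hx
          rcases Finset.mem_insert.1 (ht (Finset.mem_of_mem_erase hx)) with h | h
          · exact absurd h (Finset.ne_of_mem_erase hx)
          · exact h
        refine Or.inr ⟨t.erase v, ?_, fun h => hσρ (h.trans hsub),
          (Finset.insert_erase hv).symm⟩
        exact (K.isRelLowerSet_faces hρ).2 (Finset.union_subset_union_left hsub)
          (hσ.mono Finset.subset_union_right)
      · have hsub : t ⊆ ρ := (Finset.subset_insert_iff_of_notMem hv).1 ht
        exact Or.inl ⟨(K.isRelLowerSet_faces hρ).2 (hsub.trans Finset.subset_union_left) hne,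
          fun h => hσρ (h.trans hsub)⟩

/-- `K'` is a stellar subdivision of `K` in one of its simplices, with a new vertex. -/
def IsStellarSubdivision {V : Type*} (K K' : PreAbstractSimplicialComplex V) : Prop :=
  ∃ σ ∈ K.faces, ∃ v, v ∉ vertices K ∧ K' = stellarSubdivision K σ v

/-- Up to isomorphism of abstract simplicial complexes, `L` is obtained from `K` by a finite
sequence of stellar subdivisions. -/
def ObtainedByStellarSubdivisions {V W : Type*} (K : PreAbstractSimplicialComplex V)
    (L : PreAbstractSimplicialComplex W) : Prop :=
  ∃ (U : Type) (K₀ L₀ : PreAbstractSimplicialComplex U), Nonempty (ComplexIso K K₀) ∧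
    Relation.ReflTransGen IsStellarSubdivision K₀ L₀ ∧ Nonempty (ComplexIso L₀ L)

/-! ## Nested sets in lattices -/

section Lattice

variable {L : Type*} [Lattice L] [BoundedOrder L]

/-- `S` is nested with respect to `G`: it is a subset of `G`, and the join of any at least two
pairwise incomparable elements of `S` does not belong to `G`. -/
def IsNested (G : Set L) (S : Finset L) : Prop :=
  (S : Set L) ⊆ G ∧ ∀ A : Finset L, A ⊆ S → 2 ≤ A.card → IsAntichain (· ≤ ·) (A : Set L) →
    A.sup id ∉ G

/-- The reduced nested set complex `𝒩(L, G)`: its simplices are the nonempty `G`-nested sets that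
do not contain the maximal element. -/
def reducedNestedSetComplex (G : Set L) : PreAbstractSimplicialComplex L where
  faces := {S | S.Nonempty ∧ IsNested G S ∧ ⊤ ∉ S}
  isRelLowerSet_faces := by
    rintro S ⟨hne, ⟨hG, hj⟩, htop⟩
    exact ⟨hne, fun T hT hTne => ⟨hTne, ⟨(Finset.coe_subset.2 hT).trans hG,
      fun A hA => hj A (hA.trans hT)⟩, fun h => htop (hT h)⟩⟩

/-- The order complex of the proper part `L \ {⊥, ⊤}` of a bounded lattice. -/
def orderComplex (L : Type*) [Lattice L] [BoundedOrder L] : PreAbstractSimplicialComplex L where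
  faces := {S | S.Nonempty ∧ ⊥ ∉ S ∧ ⊤ ∉ S ∧ IsChain (· ≤ ·) (S : Set L)}
  isRelLowerSet_faces := by
    rintro S ⟨hne, hbot, htop, hc⟩
    exact ⟨hne, fun T hT hTne => ⟨hTne, fun h => hbot (hT h), fun h => htop (hT h),
      hc.mono (Finset.coe_subset.2 hT)⟩⟩

end Lattice

/-- The irreducible elements of a bounded lattice: the elements `X > ⊥` for which the interval
`[⊥, X]` is not isomorphic to a product of two posets with more than one element each. -/
def irreducibles.{u} (L : Type u) [Lattice L] [BoundedOrder L] : Set L :=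
  {X | ⊥ < X ∧ ∀ (P Q : Type u) [PartialOrder P] [PartialOrder Q],
    Nonempty (Set.Icc ⊥ X ≃o P × Q) → Subsingleton P ∨ Subsingleton Q}

/-! ## The `k`-equal lattice -/

/-- The set partition of `{1, …, n}` (as an equivalence relation) in which `B` is a block and all
elements outside `B` are singleton blocks. -/
def blockPartition {n : ℕ} (B : Set (Fin n)) : Setoid (Fin n) where
  r i j := i = j ∨ (i ∈ B ∧ j ∈ B)
  iseqv :=
    { refl := fun _ => Or.inl rfl
      symm := by
        rintro x y (rfl | ⟨h, h'⟩)
        · exact Or.inl rfl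
        · exact Or.inr ⟨h', h⟩
      trans := by
        rintro x y z (rfl | ⟨h, h'⟩) (rfl | ⟨g, g'⟩)
        · exact Or.inl rfl
        · exact Or.inr ⟨g, g'⟩
        · exact Or.inr ⟨h, h'⟩
        · exact Or.inr ⟨h, g'⟩ }

/-- The partitions of `{1, …, n}` with a single nontrivial block, which has size `k`. -/
def kBlockPartitions (n k : ℕ) : Set (Setoid (Fin n)) :=
  {π | ∃ B : Set (Fin n), B.ncard = k ∧ π = blockPartition B}

/-- The `k`-equal lattice `Π_{n,k}`: the joins, in the lattice of all set partitions of
`{1, …, n}`, of sets of partitions with a single nontrivial block of size `k` (the empty join is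
the partition into singletons). The order is the one of `Setoid`: finer partitions are smaller. -/
def KEqualLattice (n k : ℕ) : Type :=
  {π : Setoid (Fin n) // ∃ A ⊆ kBlockPartitions n k, π = sSup A}

namespace KEqualLattice

variable {n k : ℕ}

instance : PartialOrder (KEqualLattice n k) :=
  inferInstanceAs (PartialOrder {π : Setoid (Fin n) // ∃ A ⊆ kBlockPartitions n k, π = sSup A})

/-- Joins in `Π_{n,k}` are joins of partitions. -/
instance : SupSet (KEqualLattice n k) where
  sSup S := ⟨sSup (Subtype.val '' S),
    {a | a ∈ kBlockPartitions n k ∧ ∃ π ∈ S, a ≤ π.1}, fun _ h => h.1, by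
      apply le_antisymm
      · apply sSup_le
        rintro _ ⟨π, hπ, rfl⟩
        obtain ⟨A, hA, h⟩ := π.2
        rw [h]
        refine sSup_le_sSup fun a ha => ⟨hA ha, π, hπ, ?_⟩
        rw [h]
        exact le_sSup ha
      · apply sSup_le
        rintro a ⟨_, π, hπ, h⟩
        exact h.trans (le_sSup ⟨π, hπ, rfl⟩)⟩

theorem isLUB_sSup (S : Set (KEqualLattice n k)) : IsLUB S (sSup S) := by
  constructor
  · intro π hπ
    exact le_sSup (α := Setoid (Fin n)) ⟨π, hπ, rfl⟩
  · intro b hb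
    apply sSup_le (α := Setoid (Fin n))
    rintro _ ⟨π, hπ, rfl⟩
    exact hb hπ

instance : CompleteLattice (KEqualLattice n k) := completeLatticeOfSup _ isLUB_sSup

end KEqualLattice

/-! ## Trees -/

/-- A finite rooted tree with `n` leaves labelled `1, …, n`. Leaves are the vertices of degree `1`;
the root has degree at least `2`, and all other non-leaves have degree at least `3`. -/
structure LabelledTree (n : ℕ) where
  V : Type
  finite : Finite V
  graph : SimpleGraph V
  isTree : graph.IsTree
  root : V
  leaf : Fin n → V
  leaf_injective : Function.Injective leaf
  range_leaf : Set.range leaf = {v | (graph.neighborSet v).ncard = 1}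
  two_le_degree_root : 2 ≤ (graph.neighborSet root).ncard
  three_le_degree : ∀ v, v ∉ Set.range leaf → v ≠ root → 3 ≤ (graph.neighborSet v).ncard

namespace LabelledTree

variable {n : ℕ}

/-- `v` is a leaf. -/
def IsLeaf (T : LabelledTree n) (v : T.V) : Prop := v ∈ Set.range T.leaf

/-- The internal vertices: neither a leaf nor the root. -/
def IsInternal (T : LabelledTree n) (v : T.V) : Prop := ¬ T.IsLeaf v ∧ v ≠ T.root

/-- `t` lies on the path from `v` to the root, that is, `v` is below `t` (or equal to it). -/
def Below (T : LabelledTree n) (v t : T.V) : Prop :=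
  ∀ p : T.graph.Walk v T.root, p.IsPath → t ∈ p.support

/-- The children of `v`: the neighbours of `v` not on the path from `v` to the root. -/
def children (T : LabelledTree n) (v : T.V) : Set T.V :=
  {w | T.graph.Adj v w ∧ ¬ T.Below v w}

/-- The outdegree of a vertex. -/
noncomputable def outdegree (T : LabelledTree n) (v : T.V) : ℕ := (T.children v).ncard

/-- The internal edges: the edges that are not adjacent to a leaf. -/
def internalEdges (T : LabelledTree n) : Set (Sym2 T.V) :=
  {e | e ∈ T.graph.edgeSet ∧ ∀ v ∈ e, ¬ T.IsLeaf v}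

/-- The preleaves: the non-leaves all of whose children are leaves, that is, the leaves of the
rooted tree obtained by removing the leaves. -/
def IsPreleaf (T : LabelledTree n) (v : T.V) : Prop :=
  ¬ T.IsLeaf v ∧ ∀ w ∈ T.children v, T.IsLeaf w

/-- The tree is binary except at preleaves, where it is `k`-ary. -/
def IsKEqualBinary (k : ℕ) (T : LabelledTree n) : Prop :=
  ∀ v, ¬ T.IsLeaf v →
    (T.IsPreleaf v → T.outdegree v = k) ∧ (¬ T.IsPreleaf v → T.outdegree v = 2)

/-- The set of labels of the leaves below `t`. -/
def leavesBelow (T : LabelledTree n) (t : T.V) : Set (Fin n) := {i | T.Below (T.leaf i) t}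

/-- The set of partitions associated with a tree: for every internal vertex `t`, the partition
whose only nontrivial block is the set of leaves below `t`. -/
def nestedSet (T : LabelledTree n) : Set (Setoid (Fin n)) :=
  {π | ∃ t, T.IsInternal t ∧ π = blockPartition (T.leavesBelow t)}

/-- `T'` is obtained from `T` by contracting a set `E` of internal edges: `f` identifies exactly
the vertices that are joined by edges in `E`. -/
def IsContraction (T T' : LabelledTree n) : Prop :=
  ∃ E ⊆ T.internalEdges, ∃ f : T.V → T'.V, Function.Surjective f ∧
    (∀ u v, f u = f v ↔ (SimpleGraph.fromEdgeSet E).Reachable u v) ∧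
    (∀ a b, T'.graph.Adj a b ↔ a ≠ b ∧ ∃ u v, f u = a ∧ f v = b ∧ T.graph.Adj u v) ∧
    f T.root = T'.root ∧ ∀ i, f (T.leaf i) = T'.leaf i

/-- Two labelled rooted trees have the same combinatorial type if there is a label- and
root-preserving isomorphism of graphs. (As only the root may have degree `2`, every label- and
root-preserving homeomorphism maps vertices to vertices and edges to edges.) -/
instance setoid (n : ℕ) : Setoid (LabelledTree n) where
  r T T' := ∃ f : T.graph ≃g T'.graph, f T.root = T'.root ∧ ∀ i, f (T.leaf i) = T'.leaf i
  iseqv :=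
    { refl := fun _ => ⟨SimpleGraph.Iso.refl, rfl, fun _ => rfl⟩
      symm := by
        rintro T T' ⟨f, hr, hl⟩
        exact ⟨f.symm, by rw [← hr]; exact f.symm_apply_apply _,
          fun i => by rw [← hl]; exact f.symm_apply_apply _⟩
      trans := by
        rintro T T' T'' ⟨f, hr, hl⟩ ⟨g, gr, gl⟩
        exact ⟨f.trans g, (congrArg g hr).trans gr, fun i => (congrArg g (hl i)).trans (gl i)⟩ }

end LabelledTree

/-- Combinatorial types of rooted trees with `n` labelled leaves. -/
def TreeType (n : ℕ) := Quotient (LabelledTree.setoid n)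

/-- The combinatorial type of a tree. -/
def LabelledTree.type {n : ℕ} (T : LabelledTree n) : TreeType n := Quotient.mk _ T

namespace TreeType

variable {n : ℕ}

/-- `τ'` is obtained from `τ` by contracting internal edges. -/
def IsContraction (τ τ' : TreeType n) : Prop :=
  ∃ T T' : LabelledTree n, T.type = τ ∧ T'.type = τ' ∧ T.IsContraction T'

/-- Types of trees with exactly one internal edge. -/
def HasOneInternalEdge (τ : TreeType n) : Prop :=
  ∃ T : LabelledTree n, T.type = τ ∧ T.internalEdges.ncard = 1

/-- The vertices of the simplex given by `τ`: the types with exactly one internal edge that are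
obtained from `τ` by contracting internal edges. -/
def vertexSet (τ : TreeType n) : Set (TreeType n) :=
  {ν | ν.HasOneInternalEdge ∧ τ.IsContraction ν}

end TreeType

/-- The types of trees on `n` leaves which are binary except at preleaves, where they are
`k`-ary. -/
def maximalTreeTypes (n k : ℕ) : Set (TreeType n) :=
  {τ | ∃ T : LabelledTree n, T.type = τ ∧ T.IsKEqualBinary k}

/-- The types of `k`-equal trees: those obtained from the maximal ones by contracting internal
edges. -/
def kEqualTreeTypes (n k : ℕ) : Set (TreeType n) :=
  {τ | ∃ μ ∈ maximalTreeTypes n k, μ.IsContraction τ}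

/-- The complex of `k`-equal trees `T_{n,k}`, generated by the simplices given by the types of
trees which are binary except at preleaves, where they are `k`-ary. -/
def kEqualTreeComplex (n k : ℕ) : PreAbstractSimplicialComplex (TreeType n) where
  faces := {s | s.Nonempty ∧ ∃ μ ∈ maximalTreeTypes n k, (s : Set (TreeType n)) ⊆ μ.vertexSet}
  isRelLowerSet_faces := by
    rintro s ⟨hne, μ, hμ, hs⟩
    exact ⟨hne, fun t ht htne => ⟨htne, μ, hμ, (Finset.coe_subset.2 ht).trans hs⟩⟩

end TreeComplex

open TreeComplex

namespace TreeComplex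

/-!
A tree is determined by the family of the leaf sets of its internal vertices. These families are
exactly the laminar families of proper subsets with at least two elements, and contracting internal
edges means passing to a subfamily. The outdegree condition on the maximal simplices says that the
family is maximal among the laminar families of proper subsets with at least `k` elements: a vertex
with too many children can be refined by a new vertex above two of them (above `k` leaves, for a
preleaf). So the simplices of `T_{n,k}` are the nonempty laminar families of proper subsets of size
at least `k`.

The irreducible elements of `Π_{n,k}` are the partitions with a single nontrivial block, of size at
least `k`, and the join of two incomparable ones is irreducible exactly when their blocks meet.
Hence the nested sets are the laminar families as well.

For the order complex, every element of `Π_{n,k}` is the join of its factors, the maximal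
irreducible elements below it. Adding the reducible elements one by one as admissible elements, from
the largest to the smallest, subdivides the nested set complex in the simplex given by the factors
of the new element; once all elements are admissible, the nested sets are the chains.
-/

/-! ## Factors, nested sets and stellar subdivisions -/

section Factors

variable {L : Type*} [PartialOrder L]

theorem card_le_one_of_forall_le {A : Finset L} (hanti : IsAntichain (· ≤ ·) (A : Set L)) {b : L}
    (hb : b ∈ A) (hA : ∀ a ∈ A, a ≤ b) : A.card ≤ 1 :=
  Finset.card_le_one.2 fun _ ha _ hc =>
    (hanti.eq ha hb (hA _ ha)).trans (hanti.eq hc hb (hA _ hc)).symm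

variable [Finite L]

/-- The factors of `X` with respect to `G`: the maximal elements of `G` below `X`. -/
noncomputable def factors (G : Set L) (X : L) : Finset L :=
  (Set.toFinite {y | Maximal (fun z => z ∈ G ∧ z ≤ X) y}).toFinset

variable {G : Set L} {X Y : L}

theorem mem_factors : Y ∈ factors G X ↔ Maximal (fun z => z ∈ G ∧ z ≤ X) Y := by
  rw [factors, Set.Finite.mem_toFinset, Set.mem_ofPred_eq]

theorem factors_subset : (factors G X : Set L) ⊆ G := fun _ h => (mem_factors.1 h).1.1

theorem le_of_mem_factors (h : Y ∈ factors G X) : Y ≤ X := (mem_factors.1 h).1.2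

theorem isAntichain_factors : IsAntichain (· ≤ ·) (factors G X : Set L) :=
  (setOfPred_maximal_antichain _).subset fun _ h => mem_factors.1 h

theorem exists_le_mem_factors (hY : Y ∈ G) (hYX : Y ≤ X) : ∃ f ∈ factors G X, Y ≤ f := by
  obtain ⟨f, hYf, hf⟩ := (Set.toFinite {z | z ∈ G ∧ z ≤ X}).exists_le_maximal ⟨hY, hYX⟩
  exact ⟨f, mem_factors.2 hf, hYf⟩

theorem factors_of_mem (hX : X ∈ G) : factors G X = {X} := by
  ext Y
  rw [mem_factors, Finset.mem_singleton]
  refine ⟨fun h => h.eq_of_le ⟨hX, le_rfl⟩ h.1.2, ?_⟩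
  rintro rfl
  exact ⟨⟨hX, le_rfl⟩, fun Z hZ _ => hZ.2⟩

theorem factors_insert_of_not_le (hXY : ¬ X ≤ Y) : factors (insert X G) Y = factors G Y := by
  have hiff (z : L) : z ∈ insert X G ∧ z ≤ Y ↔ z ∈ G ∧ z ≤ Y :=
    ⟨fun h => ⟨h.1.resolve_left fun e => hXY (e ▸ h.2), h.2⟩, fun h => ⟨Or.inr h.1, h.2⟩⟩
  ext f
  simp only [mem_factors, hiff]

end Factors

section NestedSets

variable {L : Type*} [Lattice L] [BoundedOrder L]

theorem IsNested.mono {G : Set L} {S T : Finset L} (hS : IsNested G S) (hTS : T ⊆ S) :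
    IsNested G T :=
  ⟨(Finset.coe_subset.2 hTS).trans hS.1, fun A hA => hS.2 A (hA.trans hTS)⟩

theorem IsNested.anti_of_subset {G H : Set L} {S : Finset L} (hS : IsNested H S) (hGH : G ⊆ H)
    (hSG : (S : Set L) ⊆ G) : IsNested G S :=
  ⟨hSG, fun A hA hcard hanti hsup => hS.2 A hA hcard hanti (hGH hsup)⟩

theorem IsNested.eq_singleton_of_sup_mem {G : Set L} {A : Finset L} (hA : IsNested G A)
    (hbot : ⊥ ∉ G) (hanti : IsAntichain (· ≤ ·) (A : Set L)) (hsup : A.sup id ∈ G) :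
    A = {A.sup id} := by
  have hcard : A.card = 1 := by
    have hlt : A.card < 2 := not_le.1 fun h2 => hA.2 A subset_rfl h2 hanti hsup
    have hne : A.card ≠ 0 := by
      rw [Finset.card_ne_zero, Finset.nonempty_iff_ne_empty]
      rintro rfl
      exact hbot hsup
    omega
  obtain ⟨a, rfl⟩ := Finset.card_eq_one.1 hcard
  rw [Finset.sup_singleton, id]

theorem exists_antichain_sup_eq (A : Finset L) :
    ∃ M ⊆ A, IsAntichain (· ≤ ·) (M : Set L) ∧ M.sup id = A.sup id := by
  classical
  refine ⟨{a ∈ A | Maximal (· ∈ A) a}, Finset.filter_subset _ _, ?_, ?_⟩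
  · simp only [Finset.coe_filter]
    exact (setOfPred_maximal_antichain (· ∈ A)).subset fun a ha => ha.2
  · refine le_antisymm (Finset.sup_mono (Finset.filter_subset _ _)) (Finset.sup_le fun a ha => ?_)
    obtain ⟨b, hab, hb⟩ := A.exists_le_maximal ha
    exact hab.trans (Finset.le_sup (f := id) (Finset.mem_filter.2 ⟨hb.1, hb⟩))

theorem IsNested.le_or_ge {G : Set L} {X : L} {S : Finset L} (hS : IsNested (insert X G) S)
    (hmax : ∀ Y, X < Y → Y ∈ G) (hXS : X ∈ S) {a : L} (ha : a ∈ S) :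
    a ≤ X ∨ X ≤ a := by
  classical
  by_contra! hinc
  have hne : a ≠ X := fun e => hinc.1 e.le
  have hanti : IsAntichain (· ≤ ·) (({a, X} : Finset L) : Set L) := by
    rw [Finset.coe_pair]
    exact Set.pairwise_pair.2 fun _ => hinc
  refine hS.2 {a, X} (Finset.insert_subset ha (Finset.singleton_subset_iff.2 hXS))
    (Finset.card_pair hne).ge hanti (Or.inr (hmax _ ?_))
  rw [Finset.sup_insert, Finset.sup_singleton]
  exact right_lt_sup.2 hinc.1

theorem reducedNestedSetComplex_compl_bot :
    reducedNestedSetComplex ({⊥}ᶜ : Set L) = orderComplex L := by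
  classical
  ext S
  constructor
  · rintro ⟨hne, hS, htop⟩
    refine ⟨hne, fun hbot => hS.1 hbot rfl, htop, fun a ha b hb hab => ?_⟩
    by_contra! hinc
    have hanti : IsAntichain (· ≤ ·) (({a, b} : Finset L) : Set L) := by
      rw [Finset.coe_pair]
      exact Set.pairwise_pair.2 fun _ => hinc
    refine hS.2 {a, b} (Finset.insert_subset ha (Finset.singleton_subset_iff.2 hb))
      (Finset.card_pair hab).ge hanti fun hsup => hS.1 ha ?_
    exact le_bot_iff.1 ((Finset.le_sup (f := id) (Finset.mem_insert_self a {b})).trans hsup.le)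
  · rintro ⟨hne, hbot, htop, hchain⟩
    refine ⟨hne, ⟨fun a ha hab => hbot (hab ▸ ha), fun A hA hcard hanti _ => ?_⟩, htop⟩
    obtain ⟨a, ha, b, hb, hab⟩ := Finset.one_lt_card.1 hcard
    rcases hchain (hA ha) (hA hb) hab with hle | hle
    · exact hab (hanti.eq ha hb hle)
    · exact hab (hanti.eq hb ha hle).symm

variable [Finite L] {G : Set L} {X : L}

theorem sup_factors_le : (factors G X).sup id ≤ X :=
  Finset.sup_le fun _ hf => le_of_mem_factors hf

theorem isNested_factors : IsNested G (factors G X) := by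
  refine ⟨factors_subset, fun A hA hcard _ hsup => ?_⟩
  obtain ⟨f, hf, hAf⟩ := exists_le_mem_factors hsup ((Finset.sup_mono hA).trans sup_factors_le)
  have heq : ∀ a ∈ A, a = f := fun a ha =>
    isAntichain_factors.eq (hA ha) hf ((Finset.le_sup (f := id) ha).trans hAf)
  have : A.card ≤ 1 :=
    Finset.card_le_one.2 fun a ha b hb => (heq a ha).trans (heq b hb).symm
  omega

open Classical in
theorem IsNested.erase_union_factors {S : Finset L} (hS : IsNested (insert X G) S)
    (hmax : ∀ Y, X < Y → Y ∈ G) (hXS : X ∈ S) :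
    IsNested G (S.erase X ∪ factors G X) := by
  refine ⟨?_, fun A hA hcard hanti hsup => ?_⟩
  · rintro a ha
    rcases Finset.mem_union.1 ha with ha | ha
    · exact (hS.1 (Finset.mem_of_mem_erase ha)).resolve_left (Finset.ne_of_mem_erase ha)
    · exact factors_subset ha
  by_cases hAS : A ⊆ S
  · exact hS.2 A hAS hcard hanti (Or.inr hsup)
  obtain ⟨f, hfA, hfS⟩ := Finset.not_subset.1 hAS
  have hf : f ∈ factors G X :=
    (Finset.mem_union.1 (hA hfA)).resolve_left fun h => hfS (Finset.mem_of_mem_erase h)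
  have hAX : ∀ a ∈ A, a ≤ X := fun a ha => by
    rcases Finset.mem_union.1 (hA ha) with haS | haF
    · refine (hS.le_or_ge hmax hXS (Finset.mem_of_mem_erase haS)).elim id fun hXa => ?_
      exact hanti.eq hfA ha ((le_of_mem_factors hf).trans hXa) ▸ le_of_mem_factors hf
    · exact le_of_mem_factors haF
  obtain ⟨g, hg, hAg⟩ := exists_le_mem_factors hsup (Finset.sup_le hAX)
  have hfg : f = g := isAntichain_factors.eq hf hg ((Finset.le_sup (f := id) hfA).trans hAg)
  have := card_le_one_of_forall_le hanti hfA fun a ha =>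
    hfg ▸ (Finset.le_sup (f := id) ha).trans hAg
  omega

/-- Unique factorization with respect to `G`: every element is the join of its factors and of no
other nested antichain. Building sets in the sense of Feichtner and Kozlov have this property. -/
structure UniqueFactorization (G : Set L) : Prop where
  bot_notMem : ⊥ ∉ G
  sup_factors : ∀ X, (factors G X).sup id = X
  factors_sup_subset : ∀ A : Finset L, IsNested G A → IsAntichain (· ≤ ·) (A : Set L) →
    factors G (A.sup id) ⊆ A

namespace UniqueFactorization

theorem two_le_card_factors (hG : UniqueFactorization G) (hX : X ≠ ⊥) (hXG : X ∉ G) :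
    2 ≤ (factors G X).card := by
  by_contra! hlt
  have hsup := hG.sup_factors X
  obtain ⟨f, hf⟩ := Finset.card_le_one_iff_subset_singleton.1 (Nat.lt_succ_iff.1 hlt)
  rcases Finset.subset_singleton_iff.1 hf with h | h <;> rw [h] at hsup
  · exact hX hsup.symm
  · have hfX : f = X := by simpa only [Finset.sup_singleton, id] using hsup
    exact hXG (hfX ▸ factors_subset (Finset.mem_coe.2 (h ▸ Finset.mem_singleton_self f)))

theorem not_factors_subset (hG : UniqueFactorization G) (hX : X ≠ ⊥) (hXG : X ∉ G)
    {S : Finset L} (hS : IsNested (insert X G) S) : ¬ factors G X ⊆ S := fun hFS =>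
  hS.2 _ hFS (hG.two_le_card_factors hX hXG) isAntichain_factors
    (Or.inl (hG.sup_factors X))

theorem insert_of_forall_lt (hG : UniqueFactorization G) (hX : X ≠ ⊥) (hmax : ∀ Y, X < Y → Y ∈ G) :
    UniqueFactorization (insert X G) := by
  have hupper : ∀ Y, X ≤ Y → Y ∈ insert X G := fun Y hXY =>
    hXY.eq_or_lt.imp Eq.symm (hmax Y)
  have hbot : ⊥ ∉ insert X G := fun h => h.elim (fun e => hX e.symm) hG.bot_notMem
  refine ⟨hbot, fun Y => ?_, fun A hA hanti => ?_⟩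
  · by_cases hXY : X ≤ Y
    · rw [factors_of_mem (hupper Y hXY), Finset.sup_singleton, id]
    · rw [factors_insert_of_not_le hXY, hG.sup_factors]
  · by_cases hXA : X ≤ A.sup id
    · have hmem := hupper _ hXA
      rw [factors_of_mem hmem, ← hA.eq_singleton_of_sup_mem hbot hanti hmem]
    · rw [factors_insert_of_not_le hXA]
      refine hG.factors_sup_subset A ?_ hanti
      refine hA.anti_of_subset (Set.subset_insert X G) fun a ha => ?_
      exact (hA.1 ha).resolve_left fun e => hXA (e ▸ Finset.le_sup (f := id) ha)

theorem isNested_insert_of_not_subset (hG : UniqueFactorization G) {S : Finset L}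
    (hS : IsNested G S) (hFS : ¬ factors G X ⊆ S) : IsNested (insert X G) S := by
  refine ⟨hS.1.trans (Set.subset_insert _ _), fun A hA hcard hanti hsup => ?_⟩
  rcases hsup with hAX | hsup
  · exact hFS ((hAX ▸ hG.factors_sup_subset A (hS.mono hA) hanti).trans hA)
  · exact hS.2 A hA hcard hanti hsup

open Classical in
theorem isNested_insert_insert (hG : UniqueFactorization G) {ρ : Finset L}
    (hρ : IsNested G (ρ ∪ factors G X)) (hFρ : ¬ factors G X ⊆ ρ) :
    IsNested (insert X G) (insert X ρ) := by
  have hρG : IsNested G ρ := hρ.mono Finset.subset_union_left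
  refine ⟨?_, fun A hA hcard hanti hsup => ?_⟩
  · rw [Finset.coe_insert]
    exact Set.insert_subset_insert hρG.1
  by_cases hXA : X ∈ A
  swap
  · exact (hG.isNested_insert_of_not_subset hρG hFρ).2 A
      ((Finset.subset_insert_iff_of_notMem hXA).1 hA) hcard hanti hsup
  have hXle : X ≤ A.sup id := Finset.le_sup (f := id) hXA
  have hnle : ¬ A.sup id ≤ X := fun hle => by
    have := card_le_one_of_forall_le hanti hXA fun a ha => (Finset.le_sup (f := id) ha).trans hle
    omega
  -- Replacing `X` by its factors does not change the join, but turns `A` into a `G`-nested set.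
  have hreplace : (A.erase X ∪ factors G X).sup id = A.sup id := by
    rw [Finset.sup_union, hG.sup_factors, sup_comm]
    conv_rhs => rw [← Finset.insert_erase hXA, Finset.sup_insert, id]
  obtain ⟨M, hM, hManti, hMsup⟩ := exists_antichain_sup_eq (A.erase X ∪ factors G X)
  rw [hreplace] at hMsup
  have hMnested : IsNested G M := hρ.mono <| hM.trans <| Finset.union_subset_union_left <|
    Finset.subset_insert_iff.1 hA
  have hAG : A.sup id ∈ G := hsup.resolve_left fun e => hnle e.le
  have hmem : A.sup id ∈ M := by
    rw [hMnested.eq_singleton_of_sup_mem hG.bot_notMem hManti (hMsup.symm ▸ hAG), hMsup]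
    exact Finset.mem_singleton_self _
  rcases Finset.mem_union.1 (hM hmem) with h | h
  · exact hnle (hanti.eq hXA (Finset.mem_of_mem_erase h) hXle).ge
  · exact hnle (le_of_mem_factors h)

theorem reducedNestedSetComplex_insert (hG : UniqueFactorization G) (hX : X ≠ ⊥) (hXG : X ∉ G)
    (hmax : ∀ Y, X < Y → Y ∈ G) (htop : ⊤ ∈ G) :
    reducedNestedSetComplex (insert X G) =
      stellarSubdivision (reducedNestedSetComplex G) (factors G X) X := by
  classical
  have hXtop : X ≠ ⊤ := fun e => hXG (e ▸ htop)
  have htopF : ⊤ ∉ factors G X := fun h => hXtop (top_le_iff.1 (le_of_mem_factors h))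
  ext S
  constructor
  · rintro ⟨hne, hS, htopS⟩
    have hFS := hG.not_factors_subset hX hXG hS
    by_cases hXS : X ∈ S
    · have hFne : (factors G X).Nonempty :=
        Finset.card_pos.1 (Nat.zero_lt_two.trans_le (hG.two_le_card_factors hX hXG))
      refine Or.inr ⟨S.erase X, ⟨?_, ?_, ?_⟩, fun h => hFS (h.trans (Finset.erase_subset _ _)), ?_⟩
      · exact hFne.mono Finset.subset_union_right
      · exact hS.erase_union_factors hmax hXS
      · exact fun h => (Finset.mem_union.1 h).elim
          (fun h => htopS (Finset.mem_of_mem_erase h)) htopF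
      · convert (Finset.insert_erase hXS).symm
    · refine Or.inl ⟨⟨hne, hS.anti_of_subset (Set.subset_insert X G) fun a ha => ?_, htopS⟩, hFS⟩
      exact (hS.1 ha).resolve_left fun e => hXS (e ▸ ha)
  · rintro (⟨⟨hne, hS, htopS⟩, hFS⟩ | ⟨ρ, ⟨-, hρ, htopρ⟩, hFρ, rfl⟩)
    · exact ⟨hne, hG.isNested_insert_of_not_subset hS hFS, htopS⟩
    · refine ⟨Finset.insert_nonempty _ _, ?_, fun h => ?_⟩
      · convert hG.isNested_insert_insert (ρ := ρ) (by convert hρ) hFρ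
      · rcases Finset.mem_insert.1 h with e | h
        · exact hXtop e.symm
        · exact htopρ (Finset.mem_union_left _ h)

theorem isStellarSubdivision_insert (hG : UniqueFactorization G) (hX : X ≠ ⊥) (hXG : X ∉ G)
    (hmax : ∀ Y, X < Y → Y ∈ G) (htop : ⊤ ∈ G) :
    IsStellarSubdivision (reducedNestedSetComplex G)
      (reducedNestedSetComplex (insert X G)) := by
  refine ⟨factors G X, ⟨?_, isNested_factors, fun h => ?_⟩, X, ?_,
    hG.reducedNestedSetComplex_insert hX hXG hmax htop⟩
  · exact Finset.card_pos.1 (Nat.zero_lt_two.trans_le (hG.two_le_card_factors hX hXG))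
  · exact hXG (top_le_iff.1 (le_of_mem_factors h) ▸ htop)
  · rintro ⟨-, hn, -⟩
    exact hXG (hn.1 (Finset.mem_singleton_self X))

theorem reflTransGen_orderComplex (hG : UniqueFactorization G) (htop : ⊤ ∈ G) :
    Relation.ReflTransGen IsStellarSubdivision (reducedNestedSetComplex G) (orderComplex L) := by
  induction hm : ({⊥}ᶜ \ G).ncard generalizing G with
  | zero =>
    have hsub : {⊥}ᶜ ⊆ G := Set.sdiff_eq_empty.1 ((Set.ncard_eq_zero (Set.toFinite _)).1 hm)
    have hG' : G = {⊥}ᶜ :=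
      Set.Subset.antisymm (fun x hx e => hG.bot_notMem (Set.mem_singleton_iff.1 e ▸ hx)) hsub
    rw [hG', reducedNestedSetComplex_compl_bot]
  | succ m ih =>
    have hne : ({⊥}ᶜ \ G).Nonempty := by
      rw [← Set.ncard_pos (Set.toFinite _)]
      omega
    obtain ⟨X, hX⟩ := (Set.toFinite ({⊥}ᶜ \ G)).exists_maximal hne
    have hmax : ∀ Y, X < Y → Y ∈ G := fun Y hXY => by
      by_contra hYG
      exact hXY.not_ge (hX.2 ⟨(bot_le.trans_lt hXY).ne', hYG⟩ hXY.le)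
    refine .head (hG.isStellarSubdivision_insert hX.1.1 hX.1.2 hmax htop)
      (ih (hG.insert_of_forall_lt hX.1.1 hmax) (Or.inr htop) ?_)
    rw [← Set.union_singleton, ← Set.sdiff_sdiff, Set.ncard_sdiff_singleton_of_mem hX.1, hm,
      Nat.add_sub_cancel]

end UniqueFactorization

end NestedSets

/-! ## Irreducible elements -/

section Irreducibles

variable {L : Type*} [Lattice L]

/-- The elements below `a ⊔ b` are the joins `u ⊔ v` with `u ≤ a` and `v ≤ b`, in a unique and
monotone way: `(u, v) ↦ u ⊔ v` is an isomorphism from `Iic a × Iic b` onto `Iic (a ⊔ b)`. -/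
structure IsDecomposition (a b : L) : Prop where
  exists_sup_eq : ∀ y ≤ a ⊔ b, ∃ u ≤ a, ∃ v ≤ b, u ⊔ v = y
  le_left : ∀ {u u' v'}, u ≤ a → u' ≤ a → v' ≤ b → u ≤ u' ⊔ v' → u ≤ u'
  le_right : ∀ {v u' v'}, v ≤ b → u' ≤ a → v' ≤ b → v ≤ u' ⊔ v' → v ≤ v'

namespace IsDecomposition

variable {a b : L}

theorem symm (h : IsDecomposition a b) : IsDecomposition b a where
  exists_sup_eq y hy := by
    obtain ⟨u, hu, v, hv, rfl⟩ := h.exists_sup_eq y (sup_comm b a ▸ hy)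
    exact ⟨v, hv, u, hu, sup_comm v u⟩
  le_left hv hv' hu' hle := h.le_right hv hu' hv' (sup_comm (α := L) _ _ ▸ hle)
  le_right hu hv' hu' hle := h.le_left hu hu' hv' (sup_comm (α := L) _ _ ▸ hle)

theorem mono (h : IsDecomposition a b) {u v : L} (hu : u ≤ a) (hv : v ≤ b) :
    IsDecomposition u v where
  exists_sup_eq y hy := by
    obtain ⟨s, hs, t, ht, rfl⟩ := h.exists_sup_eq y (hy.trans (sup_le_sup hu hv))
    exact ⟨s, h.le_left hs hu hv (le_sup_left.trans hy), t,
      h.le_right ht hu hv (le_sup_right.trans hy), rfl⟩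
  le_left hs hs' ht' := h.le_left (hs.trans hu) (hs'.trans hu) (ht'.trans hv)
  le_right ht hs' ht' := h.le_right (ht.trans hv) (hs'.trans hu) (ht'.trans hv)

theorem left_lt [OrderBot L] (h : IsDecomposition a b) (hb : b ≠ ⊥) : a < a ⊔ b :=
  left_lt_sup.2 fun hba =>
    hb (le_bot_iff.1 (h.le_right le_rfl le_rfl bot_le (hba.trans le_sup_left)))

theorem nonempty_orderIso (h : IsDecomposition a b) :
    Nonempty (Set.Iic a × Set.Iic b ≃o Set.Iic (a ⊔ b)) := by
  let f (p : Set.Iic a × Set.Iic b) : Set.Iic (a ⊔ b) :=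
    ⟨p.1 ⊔ p.2, sup_le_sup p.1.2 p.2.2⟩
  have hf (p q) : f p ≤ f q ↔ p ≤ q := by
    refine ⟨fun hpq => Prod.mk_le_mk.2 ⟨?_, ?_⟩, fun hpq => sup_le_sup hpq.1 hpq.2⟩
    · exact h.le_left p.1.2 q.1.2 q.2.2 (le_sup_left.trans hpq)
    · exact h.le_right p.2.2 q.1.2 q.2.2 (le_sup_right.trans hpq)
  have hsurj : Function.Surjective f := fun y => by
    obtain ⟨u, hu, v, hv, huv⟩ := h.exists_sup_eq y y.2
    exact ⟨(⟨u, hu⟩, ⟨v, hv⟩), Subtype.ext huv⟩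
  exact ⟨RelIso.ofSurjective (OrderEmbedding.ofMapLEIff f hf) hsurj⟩

theorem of_orderIso {P Q : Type*} [PartialOrder P] [PartialOrder Q] [BoundedOrder P]
    [BoundedOrder Q] {X : L} (e : P × Q ≃o Set.Iic X) :
    IsDecomposition (e (⊤, ⊥) : L) (e (⊥, ⊤)) ∧ (e (⊤, ⊥) ⊔ e (⊥, ⊤) : L) = X := by
  have hle {p p' q q'} : (e (p, q) : L) ≤ e (p', q') ↔ p ≤ p' ∧ q ≤ q' := by
    rw [Subtype.coe_le_coe, e.le_iff_le, Prod.mk_le_mk]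
  have hex (y) (hy : y ≤ X) : ∃ p q, (e (p, q) : L) = y :=
    ⟨(e.symm ⟨y, hy⟩).1, (e.symm ⟨y, hy⟩).2, congrArg Subtype.val (e.apply_symm_apply ⟨y, hy⟩)⟩
  have hsup (p q) : (e (p, ⊥) ⊔ e (⊥, q) : L) = e (p, q) := by
    refine le_antisymm (sup_le (hle.2 ⟨le_rfl, bot_le⟩) (hle.2 ⟨bot_le, le_rfl⟩)) ?_
    obtain ⟨p', q', h⟩ := hex (e (p, ⊥) ⊔ e (⊥, q)) (sup_le (e _).2 (e _).2)
    rw [← h, hle]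
    exact ⟨(hle.1 (le_sup_left.trans h.ge)).1, (hle.1 (le_sup_right.trans h.ge)).2⟩
  have hX : (e (⊤, ⊤) : L) = X := by
    obtain ⟨p, q, h⟩ := hex X le_rfl
    exact le_antisymm (e _).2 (h.ge.trans (hle.2 ⟨le_top, le_top⟩))
  have hleft {u} (hu : u ≤ (e (⊤, ⊥) : L)) : ∃ p, (e (p, ⊥) : L) = u := by
    obtain ⟨p, q, rfl⟩ := hex u (hu.trans (e _).2)
    exact ⟨p, by rw [le_bot_iff.1 (hle.1 hu).2]⟩
  have hright {v} (hv : v ≤ (e (⊥, ⊤) : L)) : ∃ q, (e (⊥, q) : L) = v := by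
    obtain ⟨p, q, rfl⟩ := hex v (hv.trans (e _).2)
    exact ⟨q, by rw [le_bot_iff.1 (hle.1 hv).1]⟩
  refine ⟨⟨fun y hy => ?_, fun hu hu' hv' h => ?_, fun hv hu' hv' h => ?_⟩,
    (hsup ⊤ ⊤).trans hX⟩
  · obtain ⟨p, q, rfl⟩ := hex y (hy.trans (sup_le (e _).2 (e _).2))
    exact ⟨_, hle.2 ⟨le_top, le_rfl⟩, _, hle.2 ⟨le_rfl, le_top⟩, hsup p q⟩
  · obtain ⟨p, rfl⟩ := hleft hu
    obtain ⟨p', rfl⟩ := hleft hu'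
    obtain ⟨q', rfl⟩ := hright hv'
    exact hle.2 ⟨(hle.1 (h.trans (hsup p' q').le)).1, le_rfl⟩
  · obtain ⟨q, rfl⟩ := hright hv
    obtain ⟨p', rfl⟩ := hleft hu'
    obtain ⟨q', rfl⟩ := hright hv'
    exact hle.2 ⟨le_rfl, (hle.1 (h.trans (hsup p' q').le)).2⟩

end IsDecomposition

variable [BoundedOrder L] {X a b : L}

theorem mem_irreducibles_iff :
    X ∈ irreducibles L ↔ X ≠ ⊥ ∧ ∀ a b, IsDecomposition a b → a ⊔ b = X → a = ⊥ ∨ b = ⊥ := by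
  have eq_bot {a : L} (h : Subsingleton (Set.Iic a)) : a = ⊥ :=
    congrArg Subtype.val (Subsingleton.elim (⟨a, le_rfl⟩ : Set.Iic a) ⟨⊥, bot_le⟩)
  refine and_congr bot_lt_iff_ne_bot ⟨?_, ?_⟩
  · rintro h a b hab rfl
    obtain ⟨e⟩ := hab.nonempty_orderIso
    exact (h _ _ ⟨(OrderIso.setCongr _ _ Set.Icc_bot).trans e.symm⟩).imp eq_bot eq_bot
  · rintro h P Q _ _ ⟨e⟩
    let e' : P × Q ≃o Set.Iic X := e.symm.trans (OrderIso.setCongr _ _ Set.Icc_bot)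
    let : BoundedOrder P :=
      { top := (e'.symm ⊤).1
        le_top p := (e'.le_symm_apply.2 le_top : (p, (e'.symm ⊤).2) ≤ e'.symm ⊤).1
        bot := (e'.symm ⊥).1
        bot_le p := (e'.symm_apply_le.2 bot_le : e'.symm ⊥ ≤ (p, (e'.symm ⊥).2)).1 }
    let : BoundedOrder Q :=
      { top := (e'.symm ⊤).2
        le_top q := (e'.le_symm_apply.2 le_top : ((e'.symm ⊤).1, q) ≤ e'.symm ⊤).2
        bot := (e'.symm ⊥).2
        bot_le q := (e'.symm_apply_le.2 bot_le : e'.symm ⊥ ≤ ((e'.symm ⊥).1, q)).2 }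
    have hbot {p : P × Q} (hp : (e' p : L) = ⊥) : p = ⊥ :=
      e'.injective (Subtype.ext (hp.trans (congrArg Subtype.val e'.map_bot.symm)))
    obtain ⟨hdec, hsup⟩ := IsDecomposition.of_orderIso e'
    refine (h _ _ hdec hsup).imp (fun h0 => ?_) fun h0 => ?_
    · exact subsingleton_of_bot_eq_top (congrArg Prod.fst (hbot h0)).symm
    · exact subsingleton_of_bot_eq_top (congrArg Prod.snd (hbot h0)).symm

theorem IsDecomposition.le_or_le (h : IsDecomposition a b) (hX : X ∈ irreducibles L)
    (hXab : X ≤ a ⊔ b) : X ≤ a ∨ X ≤ b := by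
  obtain ⟨u, hu, v, hv, rfl⟩ := h.exists_sup_eq X hXab
  rcases (mem_irreducibles_iff.1 hX).2 u v (h.mono hu hv) rfl with rfl | rfl
  · exact Or.inr ((bot_sup_eq v).trans_le hv)
  · exact Or.inl ((sup_bot_eq u).trans_le hu)

open Classical in
theorem IsDecomposition.sup_filter_le (h : IsDecomposition a b) {A : Finset L}
    (hA : (A : Set L) ⊆ irreducibles L) (hsup : A.sup id = a ⊔ b) :
    (A.filter (· ≤ a)).sup id = a := by
  have hle : (A.filter (· ≤ a)).sup id ≤ a :=
    Finset.sup_le fun x hx => (Finset.mem_filter.1 hx).2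
  refine le_antisymm hle (h.le_left le_rfl hle le_rfl (le_sup_left.trans (hsup.symm.trans_le ?_)))
  refine Finset.sup_le fun x hx => ?_
  rcases h.le_or_le (hA hx) (hsup ▸ Finset.le_sup (f := id) hx) with hxa | hxb
  · exact le_sup_of_le_left (Finset.le_sup (f := id) (Finset.mem_filter.2 ⟨hx, hxa⟩))
  · exact le_sup_of_le_right hxb

theorem exists_isDecomposition_of_notMem_irreducibles (hX : X ≠ ⊥) (hXI : X ∉ irreducibles L) :
    ∃ a b, IsDecomposition a b ∧ a ⊔ b = X ∧ a < X ∧ b < X := by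
  rw [mem_irreducibles_iff] at hXI
  push Not at hXI
  obtain ⟨a, b, hab, rfl, ha, hb⟩ := hXI hX
  exact ⟨a, b, hab, rfl, hab.left_lt hb, sup_comm a b ▸ hab.symm.left_lt ha⟩

theorem mem_irreducibles_of_isAtom (hX : IsAtom X) : X ∈ irreducibles L := by
  by_contra hXI
  obtain ⟨a, b, -, hsup, ha, hb⟩ := exists_isDecomposition_of_notMem_irreducibles hX.1 hXI
  exact hX.1 (by rw [← hsup, hX.2 a ha, hX.2 b hb, sup_bot_eq])

variable [Finite L]

theorem sup_factors_irreducibles (X : L) : (factors (irreducibles L) X).sup id = X := by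
  induction X using WellFoundedLT.induction with
  | ind X ih =>
  refine le_antisymm sup_factors_le ?_
  by_cases hX : X = ⊥
  · exact hX ▸ bot_le
  by_cases hXI : X ∈ irreducibles L
  · rw [factors_of_mem hXI, Finset.sup_singleton, id]
  obtain ⟨a, b, -, hsup, ha, hb⟩ := exists_isDecomposition_of_notMem_irreducibles hX hXI
  have hle {c : L} (hc : c < X) : c ≤ (factors (irreducibles L) X).sup id := by
    conv_lhs => rw [← ih c hc]
    refine Finset.sup_le fun f hf => ?_
    obtain ⟨g, hg, hfg⟩ :=
      exists_le_mem_factors (factors_subset hf) ((le_of_mem_factors hf).trans hc.le)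
    exact hfg.trans (Finset.le_sup (f := id) hg)
  exact hsup ▸ sup_le (hsup ▸ hle ha) (hsup ▸ hle hb)

theorem factors_irreducibles_sup_subset {A : Finset L} (hA : IsNested (irreducibles L) A)
    (hanti : IsAntichain (· ≤ ·) (A : Set L)) : factors (irreducibles L) (A.sup id) ⊆ A := by
  classical
  induction hX : A.sup id using WellFoundedLT.induction generalizing A with
  | ind X ih =>
  by_cases hXI : X ∈ irreducibles L
  · rw [factors_of_mem hXI, ← hX,
      ← hA.eq_singleton_of_sup_mem (fun h => h.1.ne rfl) hanti (hX ▸ hXI)]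
  intro f hf
  have hfI : f ∈ irreducibles L := factors_subset hf
  have hX0 : X ≠ ⊥ := (hfI.1.trans_le (le_of_mem_factors hf)).ne'
  obtain ⟨a, b, hab, rfl, ha, hb⟩ := exists_isDecomposition_of_notMem_irreducibles hX0 hXI
  have hmem {c : L} (hc : c < a ⊔ b) (hfc : f ≤ c) (hAc : (A.filter (· ≤ c)).sup id = c) :
      f ∈ A := by
    refine Finset.filter_subset (· ≤ c) A (ih c hc (hA.mono (Finset.filter_subset _ _))
      (hanti.subset (Finset.coe_subset.2 (Finset.filter_subset _ _))) hAc (mem_factors.2 ?_))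
    exact (mem_factors.1 hf).mono (fun z hz => ⟨hz.1, hz.2.trans hc.le⟩) ⟨hfI, hfc⟩
  rcases hab.le_or_le hfI (le_of_mem_factors hf) with hfa | hfb
  · exact hmem ha hfa (hab.sup_filter_le hA.1 hX)
  · exact hmem hb hfb (hab.symm.sup_filter_le hA.1 (hX.trans (sup_comm a b)))

theorem uniqueFactorization_irreducibles : UniqueFactorization (irreducibles L) where
  bot_notMem h := h.1.ne rfl
  sup_factors := sup_factors_irreducibles
  factors_sup_subset _ := factors_irreducibles_sup_subset

end Irreducibles

/-! ## Blocks of the `k`-equal lattice -/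

section Partitions

variable {n : ℕ} {B C : Set (Fin n)} {π σ : Setoid (Fin n)} {i j l : Fin n}

theorem blockPartition_le_iff : blockPartition B ≤ π ↔ ∀ i ∈ B, ∀ j ∈ B, π i j := by
  refine ⟨fun h i hi j hj => h (Or.inr ⟨hi, hj⟩), ?_⟩
  rintro h i j (rfl | ⟨hi, hj⟩)
  · exact π.refl' i
  · exact h i hi j hj

theorem le_blockPartition_iff :
    π ≤ blockPartition B ↔ ∀ i j, π i j → i ≠ j → i ∈ B ∧ j ∈ B :=
  ⟨fun h _ _ hij hne => (h hij).resolve_left hne,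
    fun h i j hij => or_iff_not_imp_left.2 (h i j hij)⟩

theorem blockPartition_mono (h : B ⊆ C) : blockPartition B ≤ blockPartition C :=
  blockPartition_le_iff.2 fun _ hi _ hj => Or.inr ⟨h hi, h hj⟩

theorem blockPartition_le_blockPartition (hB : B.Nontrivial) :
    blockPartition B ≤ blockPartition C ↔ B ⊆ C := by
  refine ⟨fun h i hi => ?_, blockPartition_mono⟩
  obtain ⟨j, hj, hji⟩ := hB.exists_ne i
  exact (le_blockPartition_iff.1 h i j (Or.inr ⟨hi, hj⟩) hji.symm).1

theorem blockPartition_le_or_le (h : ∀ i ∈ B, ∀ j ∈ B, π i j ∨ σ i j) :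
    blockPartition B ≤ π ∨ blockPartition B ≤ σ := by
  simp only [blockPartition_le_iff]
  by_contra! ⟨⟨p, hp, q, hq, hπ⟩, ⟨r, hr, s, hs, hσ⟩⟩
  have hπrs : π r s := (h r hr s hs).resolve_right hσ
  have hpr : ¬ π p r := fun hpr => by
    have hqr : σ q r := (h q hq r hr).resolve_left fun hqr => hπ (π.trans' hpr (π.symm' hqr))
    have hqs : σ q s := (h q hq s hs).resolve_left fun hqs =>
      hπ (π.trans' (π.trans' hpr hπrs) (π.symm' hqs))
    exact hσ (σ.trans' (σ.symm' hqr) hqs)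
  have hpr' : σ p r := (h p hp r hr).resolve_left hpr
  rcases h p hp s hs with hps | hps
  · exact hpr (π.trans' hps (π.symm' hπrs))
  · exact hσ (σ.trans' (σ.symm' hpr') hps)

theorem eq_or_eq_of_rel_of_rel (hπ : π ≤ blockPartition B) (hσ : σ ≤ blockPartition Bᶜ)
    (hij : π i j) (hjl : σ j l) : i = j ∨ j = l := by
  by_contra! hne
  exact (le_blockPartition_iff.1 hσ j l hjl hne.2).1 (le_blockPartition_iff.1 hπ i j hij hne.1).2

theorem sup_rel_iff (hπ : π ≤ blockPartition B) (hσ : σ ≤ blockPartition Bᶜ) :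
    (π ⊔ σ) i j ↔ π i j ∨ σ i j := by
  let s : Setoid (Fin n) :=
    { r x y := π x y ∨ σ x y
      iseqv :=
        { refl x := Or.inl (π.refl' x)
          symm := Or.imp π.symm' σ.symm'
          trans := by
            rintro x y z (hxy | hxy) (hyz | hyz)
            · exact Or.inl (π.trans' hxy hyz)
            · rcases eq_or_eq_of_rel_of_rel hπ hσ hxy hyz with rfl | rfl
              exacts [Or.inr hyz, Or.inl hxy]
            · rcases eq_or_eq_of_rel_of_rel hπ hσ (π.symm' hyz) (σ.symm' hxy) with rfl | rfl
              exacts [Or.inr hxy, Or.inl hyz]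
            · exact Or.inr (σ.trans' hxy hyz) } }
  have hle : π ⊔ σ ≤ s := sup_le (fun _ _ => Or.inl) fun _ _ => Or.inr
  exact ⟨fun h => hle h, Or.rec (fun h => le_sup_left (a := π) h) fun h => le_sup_right (a := π) h⟩

end Partitions

/-- Any two members of the family are comparable or disjoint. -/
def Laminar {α : Type*} (F : Set (Set α)) : Prop :=
  ∀ B ∈ F, ∀ C ∈ F, B ⊆ C ∨ C ⊆ B ∨ Disjoint B C

theorem Laminar.insert {α : Type*} {F : Set (Set α)} {B : Set α} (hF : Laminar F)
    (hB : ∀ C ∈ F, B ⊆ C ∨ C ⊆ B ∨ Disjoint B C) : Laminar (insert B F) := by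
  rintro C (rfl | hC) D (rfl | hD)
  · exact Or.inl le_rfl
  · exact hB D hD
  · rcases hB C hC with h | h | h
    exacts [Or.inr (Or.inl h), Or.inl h, Or.inr (Or.inr h.symm)]
  · exact hF C hC D hD

namespace KEqualLattice

variable {n k : ℕ} {X Y Z : KEqualLattice n k} {π : Setoid (Fin n)} {B C S : Set (Fin n)}
  {i j : Fin n}

instance : Finite (KEqualLattice n k) :=
  Finite.of_injective (fun (X : KEqualLattice n k) (i j : Fin n) => X.1 i j) fun _ _ h =>
    Subtype.ext (Setoid.ext fun i j => iff_of_eq (congrFun (congrFun h i) j))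

theorem coe_le_coe : X.1 ≤ Y.1 ↔ X ≤ Y := Iff.rfl

theorem le_of_forall_blockPartition_le
    (h : ∀ C : Set (Fin n), C.ncard = k → blockPartition C ≤ X.1 → blockPartition C ≤ π) :
    X.1 ≤ π := by
  obtain ⟨A, hA, hX⟩ := X.2
  rw [hX]
  refine sSup_le fun a ha => ?_
  obtain ⟨C, hC, rfl⟩ := hA ha
  exact h C hC (hX ▸ le_sSup ha)

theorem exists_blockPartition_le (hij : i ≠ j) (hr : X.1 i j) :
    ∃ C : Set (Fin n), C.ncard = k ∧ i ∈ C ∧ blockPartition C ≤ X.1 := by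
  by_contra! hC
  have hle : X.1 ≤ blockPartition {i}ᶜ := le_of_forall_blockPartition_le fun C hCk hCX =>
    blockPartition_mono fun x hx hxi => hC C hCk (Set.mem_singleton_iff.1 hxi ▸ hx) hCX
  exact (le_blockPartition_iff.1 hle i j hr hij).1 rfl

variable (k) in
/-- The largest element of `Π_{n,k}` whose nontrivial classes lie in `B`. If `B` has at least
`k ≥ 2` elements, this is the partition with `B` as only nontrivial block; if it has fewer than
`k` elements, this is `⊥`. -/
def block (B : Set (Fin n)) : KEqualLattice n k :=
  sSup {X | X.1 ≤ blockPartition B}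

theorem block_le_blockPartition : (block k B).1 ≤ blockPartition B :=
  sSup_le (α := Setoid (Fin n)) fun _ ⟨_, hX, h⟩ => h ▸ hX

theorem le_block_iff : X ≤ block k B ↔ X.1 ≤ blockPartition B :=
  ⟨fun h => (coe_le_coe.2 h).trans block_le_blockPartition, fun h => le_sSup h⟩

theorem block_mono (h : B ⊆ C) : block k B ≤ block k C :=
  le_block_iff.2 (block_le_blockPartition.trans (blockPartition_mono h))

theorem block_val_of_ncard_eq (hB : B.ncard = k) : (block k B).1 = blockPartition B := by
  refine le_antisymm block_le_blockPartition ?_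
  let X : KEqualLattice n k :=
    ⟨blockPartition B, {blockPartition B}, Set.singleton_subset_iff.2 ⟨B, hB, rfl⟩,
      sSup_singleton.symm⟩
  exact coe_le_coe.2 (le_block_iff.2 le_rfl : X ≤ block k B)

theorem block_val (hk : 2 ≤ k) (hB : k ≤ B.ncard) : (block k B).1 = blockPartition B := by
  refine le_antisymm block_le_blockPartition (blockPartition_le_iff.2 fun i hi j hj => ?_)
  obtain ⟨C, hijC, hCB, hC⟩ := Set.exists_subsuperset_card_eq
    (Set.insert_subset hi (Set.singleton_subset_iff.2 hj))
    ((Set.ncard_insert_le i {j}).trans (by rwa [Set.ncard_singleton])) hB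
  have hle : block k C ≤ block k B := block_mono hCB
  rw [← coe_le_coe, block_val_of_ncard_eq hC, blockPartition_le_iff] at hle
  exact hle i (hijC (Set.mem_insert i {j})) j (hijC (Set.mem_insert_of_mem i rfl))

theorem ne_bot_iff : X ≠ ⊥ ↔ ∃ i j, X.1 i j ∧ i ≠ j := by
  let Z : KEqualLattice n k := ⟨⊥, ∅, Set.empty_subset _, sSup_empty.symm⟩
  have hbot : (⊥ : KEqualLattice n k).1 ≤ ⊥ := coe_le_coe.2 (bot_le : ⊥ ≤ Z)
  refine ⟨fun h => ?_, ?_⟩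
  · by_contra! hX
    exact h (le_bot_iff.1 fun i j hij => hX i j hij ▸ Setoid.refl' _ i)
  · rintro ⟨i, j, hij, hne⟩ rfl
    exact hne (hbot hij)

theorem sup_val : (X ⊔ Y).1 = X.1 ⊔ Y.1 :=
  calc (X ⊔ Y).1 = (sSup {X, Y}).1 := congrArg Subtype.val (sSup_pair (α := KEqualLattice n k)).symm
    _ = sSup {X.1, Y.1} := congrArg sSup (Set.image_pair Subtype.val X Y)
    _ = X.1 ⊔ Y.1 := sSup_pair

theorem sup_rel_iff (hX : X ≤ block k S) (hY : Y ≤ block k Sᶜ) :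
    (X ⊔ Y).1 i j ↔ X.1 i j ∨ Y.1 i j := by
  rw [sup_val, TreeComplex.sup_rel_iff (le_block_iff.1 hX) (le_block_iff.1 hY)]

theorem le_of_le_sup (hX : X ≤ block k S) (hY : Y ≤ block k S)
    (hZ : Z ≤ block k Sᶜ) (h : X ≤ Y ⊔ Z) : X ≤ Y := by
  refine coe_le_coe.1 fun i j hij => ((sup_rel_iff hY hZ).1 (h hij)).elim id fun hZij => ?_
  have heq := eq_or_eq_of_rel_of_rel (le_block_iff.1 hX) (le_block_iff.1 hZ) hij (Z.1.symm' hZij)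
  rw [heq.elim id Eq.symm]

theorem isDecomposition_block_compl (S : Set (Fin n)) :
    IsDecomposition (block k S) (block k Sᶜ) where
  exists_sup_eq W hW := by
    refine ⟨W ⊓ block k S, inf_le_right, W ⊓ block k Sᶜ, inf_le_right,
      le_antisymm (sup_le inf_le_left inf_le_left) ?_⟩
    refine coe_le_coe.1 (le_of_forall_blockPartition_le fun C hC hCW => ?_)
    rw [← block_val_of_ncard_eq hC, coe_le_coe] at hCW ⊢
    have hCS : block k C ≤ block k S ∨ block k C ≤ block k Sᶜ := by
      simp only [← coe_le_coe, block_val_of_ncard_eq hC]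
      refine blockPartition_le_or_le fun i hi j hj =>
        (sup_rel_iff le_rfl le_rfl).1 (hW (hCW ?_))
      exact (block_val_of_ncard_eq hC).ge (Or.inr ⟨hi, hj⟩)
    exact hCS.elim (fun h => le_sup_of_le_left (le_inf hCW h))
      fun h => le_sup_of_le_right (le_inf hCW h)
  le_left hU hU' hV' h := le_of_le_sup hU hU' hV' h
  le_right {V U' V'} hV hU' hV' h :=
    le_of_le_sup hV hV' ((compl_compl S).symm ▸ hU') (sup_comm U' V' ▸ h)

theorem le_block_sup_block_compl (hS : ∀ i ∈ S, ∀ j, X.1 i j → j ∈ S) :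
    X ≤ block k S ⊔ block k Sᶜ := by
  refine coe_le_coe.1 (le_of_forall_blockPartition_le fun C hC hCX => ?_)
  rw [← block_val_of_ncard_eq hC, coe_le_coe]
  rw [blockPartition_le_iff] at hCX
  by_cases h : ∃ i ∈ C, i ∈ S
  · obtain ⟨i, hiC, hiS⟩ := h
    exact le_sup_of_le_left (block_mono fun j hj => hS i hiS j (hCX i hiC j hj))
  · exact le_sup_of_le_right (block_mono fun j hj hjS => h ⟨j, hj, hjS⟩)

theorem isAtom_block (hk : 2 ≤ k) (hC : C.ncard = k) : IsAtom (block k C) := by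
  have hC' : C.Nontrivial := Set.one_lt_ncard_iff_nontrivial.1 (hC ▸ hk)
  have hCval := block_val_of_ncard_eq hC
  refine ⟨?_, fun Y hY => ?_⟩
  · obtain ⟨i, hi, j, hj, hij⟩ := hC'
    exact ne_bot_iff.2 ⟨i, j, hCval.ge (Or.inr ⟨hi, hj⟩), hij⟩
  · by_contra hY0
    obtain ⟨i, j, hij, hne⟩ := ne_bot_iff.1 hY0
    obtain ⟨D, hD, -, hDY⟩ := exists_blockPartition_le hne hij
    have hDC : D ⊆ C := (blockPartition_le_blockPartition
      (Set.one_lt_ncard_iff_nontrivial.1 (hD ▸ hk))).1 (hDY.trans (hCval ▸ coe_le_coe.2 hY.le))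
    have : D = C := Set.eq_of_subset_of_ncard_le hDC (hC.trans hD.symm).le
    exact hY.not_ge (coe_le_coe.1 (hCval ▸ this ▸ hDY))

theorem block_ne_bot (hk : 2 ≤ k) (hB : k ≤ B.ncard) : block k B ≠ ⊥ := by
  obtain ⟨C, hCB, hC⟩ := Set.exists_subset_card_eq hB
  exact fun h => (isAtom_block hk hC).1 (le_bot_iff.1 (h ▸ block_mono hCB))

theorem block_mem_irreducibles (hk : 2 ≤ k) (hB : k ≤ B.ncard) :
    block k B ∈ irreducibles (KEqualLattice n k) := by
  refine mem_irreducibles_iff.2 ⟨block_ne_bot hk hB, fun a b hab hsup => ?_⟩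
  have hpair : ∀ i ∈ B, ∀ j ∈ B, a.1 i j ∨ b.1 i j := fun i hi j hj => by
    obtain ⟨C, hijC, hCB, hC⟩ := Set.exists_subsuperset_card_eq
      (Set.insert_subset hi (Set.singleton_subset_iff.2 hj))
      ((Set.ncard_insert_le i {j}).trans (by rwa [Set.ncard_singleton])) hB
    have hij : (block k C).1 i j := (block_val_of_ncard_eq hC).ge
      (Or.inr ⟨hijC (Set.mem_insert i {j}), hijC (Set.mem_insert_of_mem i rfl)⟩)
    exact (hab.le_or_le (mem_irreducibles_of_isAtom (isAtom_block hk hC))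
      (hsup ▸ block_mono hCB)).imp (fun h => h hij) fun h => h hij
  rcases blockPartition_le_or_le hpair with h | h <;> rw [← block_val hk hB, coe_le_coe] at h
  · by_contra! hne
    exact (hab.left_lt hne.2).not_ge (hsup ▸ h)
  · by_contra! hne
    exact (hab.symm.left_lt hne.1).not_ge (sup_comm a b ▸ hsup ▸ h)

theorem mem_irreducibles_iff (hk : 2 ≤ k) :
    X ∈ irreducibles (KEqualLattice n k) ↔ ∃ B : Set (Fin n), k ≤ B.ncard ∧ X = block k B := by
  refine ⟨fun hX => ?_, ?_⟩
  · obtain ⟨i, j, hij, hne⟩ := ne_bot_iff.1 hX.1.ne'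
    obtain ⟨C, hC, hiC, hCX⟩ := exists_blockPartition_le hne hij
    let B : Set (Fin n) := {l | X.1 i l}
    have hB : k ≤ B.ncard :=
      hC ▸ Set.ncard_le_ncard fun l hl => blockPartition_le_iff.1 hCX i hiC l hl
    have hBX : block k B ≤ X := by
      rw [← coe_le_coe, block_val hk hB, blockPartition_le_iff]
      exact fun l hl m hm => X.1.trans' (X.1.symm' hl) hm
    refine ⟨B, hB, le_antisymm ?_ hBX⟩
    refine ((isDecomposition_block_compl B).le_or_le hX
      (le_block_sup_block_compl fun l hl m hm => X.1.trans' hl hm)).resolve_right fun hle => ?_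
    exact (le_blockPartition_iff.1 (le_block_iff.1 hle) i j hij hne).1 (X.1.refl' i)
  · rintro ⟨B, hB, rfl⟩
    exact block_mem_irreducibles hk hB

theorem block_le_block (hk : 2 ≤ k) (hB : k ≤ B.ncard) : block k B ≤ block k C ↔ B ⊆ C := by
  rw [le_block_iff, block_val hk hB,
    blockPartition_le_blockPartition (Set.one_lt_ncard_iff_nontrivial.1 (hk.trans hB))]

theorem block_injOn (hk : 2 ≤ k) :
    Set.InjOn (block k) {B : Set (Fin n) | k ≤ B.ncard} := fun _ hB _ hC h =>
  ((block_le_block hk hB).1 h.le).antisymm ((block_le_block hk hC).1 h.ge)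

theorem block_eq_top_iff (hk : 2 ≤ k) (hkn : k ≤ n) (hB : k ≤ B.ncard) :
    block k B = ⊤ ↔ B = Set.univ := by
  have htop : block k (Set.univ : Set (Fin n)) = ⊤ :=
    top_le_iff.1 (le_block_iff.2 fun i j _ => Or.inr ⟨Set.mem_univ i, Set.mem_univ j⟩)
  exact ⟨fun h => block_injOn hk hB (by simpa using hkn) (h.trans htop.symm), fun h => h ▸ htop⟩

theorem top_mem_irreducibles (hk : 2 ≤ k) (hkn : k ≤ n) :
    ⊤ ∈ irreducibles (KEqualLattice n k) := by
  have huniv : k ≤ (Set.univ : Set (Fin n)).ncard := by simpa using hkn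
  exact (block_eq_top_iff hk hkn huniv).2 rfl ▸ block_mem_irreducibles hk huniv

theorem block_sup_block (hk : 2 ≤ k) (hB : k ≤ B.ncard) (hC : k ≤ C.ncard)
    (h : ¬ Disjoint B C) : block k B ⊔ block k C = block k (B ∪ C) := by
  refine le_antisymm (sup_le (block_mono Set.subset_union_left)
    (block_mono Set.subset_union_right)) ?_
  obtain ⟨l, hlB, hlC⟩ := Set.not_disjoint_iff.1 h
  rw [← coe_le_coe, block_val hk (hB.trans (Set.ncard_le_ncard Set.subset_union_left)),
    sup_val, block_val hk hB, block_val hk hC]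
  set π := blockPartition B ⊔ blockPartition C
  have hl : ∀ i ∈ B ∪ C, π i l := by
    rintro i (hi | hi)
    · exact le_sup_left (a := blockPartition B) (Or.inr ⟨hi, hlB⟩)
    · exact le_sup_right (a := blockPartition B) (Or.inr ⟨hi, hlC⟩)
  exact blockPartition_le_iff.2 fun i hi j hj => π.trans' (hl i hi) (π.symm' (hl j hj))

theorem laminar_of_isNested (hk : 2 ≤ k) {A : Finset (KEqualLattice n k)}
    (hA : IsNested (irreducibles (KEqualLattice n k)) A) :
    Laminar {B : Set (Fin n) | k ≤ B.ncard ∧ block k B ∈ A} := by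
  classical
  rintro B ⟨hB, hBA⟩ C ⟨hC, hCA⟩
  by_contra! ⟨hBC, hCB, hdisj⟩
  rw [← block_le_block hk hB] at hBC
  rw [← block_le_block hk hC] at hCB
  refine hA.2 {block k B, block k C} (by simp [Finset.insert_subset_iff, hBA, hCA])
    (Finset.card_pair fun h => hBC h.le).ge ?_ ?_
  · simp [IsAntichain, Set.pairwise_pair, hBC, hCB]
  · rw [Finset.sup_insert, Finset.sup_singleton, id, id, block_sup_block hk hB hC hdisj]
    exact block_mem_irreducibles hk (hB.trans (Set.ncard_le_ncard Set.subset_union_left))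

theorem isNested_of_laminar (hk : 2 ≤ k) {F : Set (Set (Fin n))} (hF : Laminar F)
    (hFk : ∀ B ∈ F, k ≤ B.ncard) {A : Finset (KEqualLattice n k)} (hA : block k '' F = A) :
    IsNested (irreducibles (KEqualLattice n k)) A := by
  refine ⟨hA ▸ Set.image_subset_iff.2 fun B hB => block_mem_irreducibles hk (hFk B hB),
    fun M hMA hM hanti hirr => ?_⟩
  have hMF : ∀ X ∈ M, ∃ B ∈ F, block k B = X := fun X hX => hA.symm.subset (hMA hX)
  obtain ⟨X, hX⟩ := Finset.card_pos.1 (zero_lt_two.trans_le hM)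
  obtain ⟨B, hB, rfl⟩ := hMF X hX
  have hle : M.sup id ≤ block k B ⊔ block k Bᶜ := by
    refine Finset.sup_le fun Y hY => ?_
    obtain ⟨C, hC, rfl⟩ := hMF Y hY
    rcases hF B hB C hC with h | h | h
    · exact le_sup_of_le_left (hanti.eq hX hY (block_mono h)).ge
    · exact le_sup_of_le_left (block_mono h)
    · exact le_sup_of_le_right (block_mono h.symm.subset_compl_right)
  rcases (isDecomposition_block_compl B).le_or_le hirr hle with h | h
  · exact hM.not_gt (Nat.lt_succ_of_le (card_le_one_of_forall_le hanti hX
      fun Y hY => (Finset.le_sup (f := id) hY).trans h))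
  · have hBc := (block_le_block hk (hFk B hB)).1 ((Finset.le_sup (f := id) hX).trans h)
    have hBk := hFk B hB
    rw [disjoint_self.1 (Set.disjoint_left.2 fun i hi hi' => hBc hi hi'), Set.bot_eq_empty,
      Set.ncard_empty] at hBk
    omega

theorem isNested_irreducibles_iff (hk : 2 ≤ k) {A : Finset (KEqualLattice n k)} :
    IsNested (irreducibles (KEqualLattice n k)) A ↔
      ∃ F : Set (Set (Fin n)), Laminar F ∧ (∀ B ∈ F, k ≤ B.ncard) ∧ block k '' F = A := by
  refine ⟨fun hA => ⟨_, laminar_of_isNested hk hA, fun B hB => hB.1, ?_⟩,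
    fun ⟨F, hF, hFk, hFA⟩ => isNested_of_laminar hk hF hFk hFA⟩
  refine Set.Subset.antisymm (Set.image_subset_iff.2 fun B hB => hB.2) fun X hX => ?_
  obtain ⟨B, hB, rfl⟩ := (mem_irreducibles_iff hk).1 (hA.1 hX)
  exact ⟨B, ⟨hB, hX⟩, rfl⟩

theorem reflTransGen_orderComplex (hk : 2 ≤ k) (hkn : k ≤ n) :
    Relation.ReflTransGen IsStellarSubdivision
      (reducedNestedSetComplex (irreducibles (KEqualLattice n k)))
      (orderComplex (KEqualLattice n k)) :=
  uniqueFactorization_irreducibles.reflTransGen_orderComplex (top_mem_irreducibles hk hkn)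

end KEqualLattice

/-! ## Rooted trees as orders -/

open SimpleGraph

section RootedTree

variable {V : Type*} {G : SimpleGraph V} {r u v w : V}

/-- In a tree with root `r`, the vertex `u` is below `v` if `v` lies on the path from `u` to `r`. -/
def RootedLE (G : SimpleGraph V) (r u v : V) : Prop :=
  ∀ p : G.Walk u r, p.IsPath → v ∈ p.support

theorem RootedLE.trans (huv : RootedLE G r u v) (hvw : RootedLE G r v w) : RootedLE G r u w := by
  classical
  intro p hp
  exact p.support_dropUntil_subset_support (huv p hp) (hvw _ (hp.dropUntil (huv p hp)))

theorem rootedLE_iff_mem_support (hG : G.IsTree) {p : G.Walk u r} (hp : p.IsPath) :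
    RootedLE G r u v ↔ v ∈ p.support :=
  ⟨fun h => h p hp, fun h _ hq => (hG.existsUnique_path u r).unique hp hq ▸ h⟩

theorem RootedLE.antisymm (hG : G.IsTree) (huv : RootedLE G r u v) (hvu : RootedLE G r v u) :
    u = v := by
  obtain ⟨p, hp, -⟩ := hG.existsUnique_path u r
  have hvp := huv p hp
  cases p with
  | nil => exact (List.mem_singleton.1 hvp).symm
  | cons h p =>
    obtain ⟨hp, hu⟩ := (Walk.cons_isPath_iff h p).1 hp
    refine (List.mem_cons.1 hvp).elim Eq.symm fun hvp => (hu ?_).elim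
    exact ((rootedLE_iff_mem_support hG hp).2 hvp).trans hvu p hp

/-- The order of the vertices of a tree with root `r`, which is the largest element. -/
abbrev rootedOrder (hG : G.IsTree) (r : V) : PartialOrder V where
  le := RootedLE G r
  le_refl _ p _ := p.start_mem_support
  le_trans _ _ _ := RootedLE.trans
  le_antisymm _ _ := RootedLE.antisymm hG

theorem rootedLE_root (u : V) : RootedLE G r u r := fun p _ => p.end_mem_support

theorem RootedLE.total (hG : G.IsTree) (huv : RootedLE G r u v) (huw : RootedLE G r u w) :
    RootedLE G r v w ∨ RootedLE G r w v := by
  obtain ⟨p, hp, -⟩ := hG.existsUnique_path u r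
  replace huv := huv p hp
  replace huw := huw p hp
  induction p with
  | nil =>
    rw [List.mem_singleton.1 huw]
    exact Or.inl (rootedLE_root v)
  | cons h p ih =>
    rcases List.mem_cons.1 huv with rfl | hv
    · exact Or.inl ((rootedLE_iff_mem_support hG hp).2 huw)
    · rcases List.mem_cons.1 huw with rfl | hw
      · exact Or.inr ((rootedLE_iff_mem_support hG hp).2 huv)
      · exact ih hp.of_cons hv hw

theorem covBy_of_isPath_cons (hG : G.IsTree) {p : G.Walk v r} (h : G.Adj u v)
    (hp : (Walk.cons h p).IsPath) : letI := rootedOrder hG r; u ⋖ v := by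
  let := rootedOrder hG r
  have hle {c : V} : u ≤ c ↔ c = u ∨ v ≤ c :=
    (rootedLE_iff_mem_support hG hp).trans
      (List.mem_cons.trans (or_congr_right (rootedLE_iff_mem_support hG hp.of_cons).symm))
  refine ⟨(hle.2 (Or.inr le_rfl)).lt_of_ne h.ne, fun c huc hcv => ?_⟩
  exact (hle.1 huc.le).elim huc.ne' hcv.not_ge

theorem hasse_rootedOrder (hG : G.IsTree) (r : V) : letI := rootedOrder hG r; hasse V = G := by
  let := rootedOrder hG r
  have covBy_or {u v : V} (h : G.Adj u v) : u ⋖ v ∨ v ≤ u := by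
    obtain ⟨p, hp, -⟩ := hG.existsUnique_path v r
    by_cases hu : u ∈ p.support
    · exact Or.inr ((rootedLE_iff_mem_support hG hp).2 hu)
    · exact Or.inl (covBy_of_isPath_cons hG h (hp.cons hu))
  have adj_of_covBy {u v : V} (h : u ⋖ v) : G.Adj u v := by
    obtain ⟨p, hp, -⟩ := hG.existsUnique_path u r
    have hvp := h.le p hp
    cases p with
    | nil => exact (h.ne (List.mem_singleton.1 hvp).symm).elim
    | cons hadj p =>
      have hcov := covBy_of_isPath_cons hG hadj hp
      have hle : _ ≤ v := (rootedLE_iff_mem_support hG hp.of_cons).2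
        ((List.mem_cons.1 hvp).resolve_left h.ne')
      exact hle.eq_of_not_lt (h.2 hcov.lt) ▸ hadj
  ext u v
  refine ⟨fun h => h.elim adj_of_covBy fun h => (adj_of_covBy h).symm, fun h => ?_⟩
  rcases covBy_or h with h' | h'
  · exact Or.inl h'
  · exact Or.inr ((covBy_or h.symm).resolve_right fun h'' => h.ne (h''.antisymm h'))

end RootedTree

/-- An order in which the elements above any given element form a chain, like that of the vertices
of a rooted tree whose root is the largest element. -/
class IsTreeOrder (V : Type*) [LE V] : Prop where
  le_or_ge_of_le_of_le : ∀ {u v w : V}, u ≤ v → u ≤ w → v ≤ w ∨ w ≤ v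

theorem isTreeOrder_rootedOrder {V : Type*} {G : SimpleGraph V} (hG : G.IsTree) (r : V) :
    letI := rootedOrder hG r; IsTreeOrder V :=
  letI := rootedOrder hG r
  ⟨RootedLE.total hG⟩

theorem exists_walk_top {V : Type*} [PartialOrder V] [OrderTop V] [Finite V] (u : V) :
    ∃ p : (hasse V).Walk u ⊤, ∀ v ∈ p.support, u ≤ v := by
  induction u using WellFoundedGT.induction with
  | ind u ih =>
    rcases eq_or_ne u ⊤ with rfl | hu
    · exact ⟨.nil, by simp⟩
    · obtain ⟨v, huv, -⟩ := exists_covBy_le_of_lt hu.lt_top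
      obtain ⟨p, hp⟩ := ih v huv.lt
      refine ⟨.cons (Or.inl huv) p, fun w hw => ?_⟩
      exact (List.mem_cons.1 hw).elim Eq.ge fun hw => huv.le.trans (hp w hw)

section TreeOrder

variable {V : Type*} [PartialOrder V] [IsTreeOrder V] {u v w : V} {H : SimpleGraph V}

theorem le_or_ge_of_le_of_le (hv : u ≤ v) (hw : u ≤ w) : v ≤ w ∨ w ≤ v :=
  IsTreeOrder.le_or_ge_of_le_of_le hv hw

theorem le_of_covBy_of_lt (hv : u ⋖ v) (hw : u < w) : v ≤ w :=
  (le_or_ge_of_le_of_le hv.le hw.le).elim id fun h => (h.eq_of_not_lt (hv.2 hw)).ge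

theorem covBy_unique (hv : u ⋖ v) (hw : u ⋖ w) : v = w :=
  (le_of_covBy_of_lt hv hw.lt).antisymm (le_of_covBy_of_lt hw hv.lt)

theorem lt_of_adj_of_lt (huv : (hasse V).Adj u v) (hu : u < w) (hv : v ≠ w) : v < w :=
  huv.elim (fun h => (le_of_covBy_of_lt h hu).lt_of_ne hv) fun h => h.lt.trans hu

theorem exists_le_of_reachable (hH : H ≤ hasse V) (h : H.Reachable u v) :
    ∃ w, u ≤ w ∧ v ≤ w ∧ H.Reachable u w := by
  obtain ⟨p⟩ := h
  induction p with
  | nil => exact ⟨_, le_rfl, le_rfl, .rfl⟩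
  | @cons u u' v hadj _ ih =>
    obtain ⟨w, huw, hvw, hreach⟩ := ih
    rcases hH hadj with h | h
    · exact ⟨w, h.le.trans huw, hvw, hadj.reachable.trans hreach⟩
    · rcases huw.eq_or_lt with rfl | hlt
      · exact ⟨u, le_rfl, hvw.trans h.le, .rfl⟩
      · exact ⟨w, le_of_covBy_of_lt h hlt, hvw, hadj.reachable.trans hreach⟩

theorem mem_support_of_le_of_not_lt (hH : H ≤ hasse V) (q : H.Walk u w) (hu : u ≤ v)
    (hw : ¬ w < v) : v ∈ q.support := by
  induction q with
  | nil => exact List.mem_singleton.2 (hu.eq_of_not_lt hw).symm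
  | @cons u u' w hadj q ih =>
    refine List.mem_cons.2 (or_iff_not_imp_left.2 fun hvu => ?_)
    by_cases hu' : u' = v
    · exact hu' ▸ q.start_mem_support
    · exact ih (lt_of_adj_of_lt (hH hadj) (hu.lt_of_ne' hvu) hu').le hw

theorem reachable_of_le_of_not_lt (hH : H ≤ hasse V) (h : H.Reachable u w) (hu : u ≤ v)
    (hw : ¬ w < v) : H.Reachable u v := by
  classical
  obtain ⟨q⟩ := h
  exact (q.takeUntil v (mem_support_of_le_of_not_lt hH q hu hw)).reachable

theorem isAcyclic_hasse : (hasse V).IsAcyclic := by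
  refine isAcyclic_iff_forall_adj_isBridge.2 ?_
  have isBridge_of_covBy {u v : V} (huv : u ⋖ v) : (hasse V).IsBridge s(u, v) := by
    rw [isBridge_iff]
    have closed {x y : V} (hx : x ≤ u) (hxy : ((hasse V).deleteEdges {s(u, v)}).Adj x y) :
        y ≤ u := by
      obtain ⟨hadj, hne⟩ := deleteEdges_adj.1 hxy
      rcases hx.eq_or_lt with rfl | hlt
      · refine hadj.elim (fun h => (hne ?_).elim) CovBy.le
        exact covBy_unique huv h ▸ rfl
      · exact or_iff_not_imp_left.2 (lt_of_adj_of_lt hadj hlt) |>.elim Eq.le le_of_lt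
    rintro ⟨p⟩
    have hle : ∀ {x y : V}, ((hasse V).deleteEdges {s(u, v)}).Walk x y → x ≤ u → y ≤ u := by
      intro x y p hx
      induction p with
      | nil => exact hx
      | cons hadj _ ih => exact ih (closed hx hadj)
    exact huv.lt.not_ge (hle p le_rfl)
  rintro u v (huv | hvu)
  · exact isBridge_of_covBy huv
  · exact Sym2.eq_swap ▸ isBridge_of_covBy hvu

variable [OrderTop V] [Finite V]

theorem isTree_hasse : (hasse V).IsTree := by
  have htop (u : V) : (hasse V).Reachable u ⊤ := (exists_walk_top u).nonempty
  exact ⟨⟨fun u v => (htop u).trans (htop v).symm⟩, isAcyclic_hasse⟩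

theorem rootedLE_hasse : RootedLE (hasse V) ⊤ u v ↔ u ≤ v := by
  classical
  refine ⟨fun h => ?_, fun huv p _ => mem_support_of_le_of_not_lt le_rfl p huv not_top_lt⟩
  obtain ⟨p, hp⟩ := exists_walk_top u
  exact hp v (p.support_toPath_subset_support (h _ p.toPath.2))

end TreeOrder

section NeighborSet

variable {V : Type*} [PartialOrder V] {v : V}

theorem neighborSet_hasse : (hasse V).neighborSet v = {w | w ⋖ v} ∪ {w | v ⋖ w} := by
  ext w
  exact or_comm

theorem ncard_neighborSet_top [OrderTop V] :
    ((hasse V).neighborSet ⊤).ncard = {w : V | w ⋖ ⊤}.ncard := by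
  rw [neighborSet_hasse]
  congr 1
  exact Set.union_eq_left.2 fun w hw => (not_top_lt hw.lt).elim

theorem ncard_neighborSet_of_ne_top [IsTreeOrder V] [OrderTop V] [Finite V] (hv : v ≠ ⊤) :
    ((hasse V).neighborSet v).ncard = {w | w ⋖ v}.ncard + 1 := by
  obtain ⟨p, hp, -⟩ := exists_covBy_le_of_lt hv.lt_top
  have hparent : {w | v ⋖ w} = {p} := by
    ext w
    exact ⟨fun hw => covBy_unique hw hp, fun hw => hw ▸ hp⟩
  rw [neighborSet_hasse, hparent, Set.union_singleton, Set.ncard_insert_of_notMem]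
  exact fun h => hp.lt.not_gt h.lt

end NeighborSet

section TreeMap

variable {V W : Type*} [PartialOrder V] [PartialOrder W] [OrderTop V] [OrderTop W] [Finite V]
  {f : V → W}

theorem exists_ge_of_map_le [IsTreeOrder W]
    (hadj : ∀ u v, u ⋖ v → f u = f v ∨ (hasse W).Adj (f u) (f v)) (htop : f ⊤ = ⊤) {v : V} {b : W}
    (h : f v ≤ b) : ∃ w, v ≤ w ∧ f w = b := by
  induction v using WellFoundedGT.induction with
  | ind v ih =>
    rcases h.eq_or_lt with rfl | hlt
    · exact ⟨v, le_rfl, rfl⟩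
    have hv : v ≠ ⊤ := by
      rintro rfl
      exact not_top_lt (htop ▸ hlt)
    obtain ⟨v', hcov, -⟩ := exists_covBy_le_of_lt hv.lt_top
    suffices h' : f v' ≤ b from (ih v' hcov.lt h').imp fun w => And.imp_left hcov.le.trans
    rcases hadj v v' hcov with heq | hadj'
    · exact heq ▸ h
    · by_cases hb : f v' = b
      · exact hb.le
      · exact (lt_of_adj_of_lt hadj' hlt hb).le

theorem monotone_of_adj [IsTreeOrder W]
    (hadj : ∀ u v, u ⋖ v → f u = f v ∨ (hasse W).Adj (f u) (f v)) (htop : f ⊤ = ⊤)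
    (hfib : ∀ b, (f ⁻¹' {b}).OrdConnected) : Monotone f := by
  classical
  have := Fintype.ofFinite V
  let := Fintype.toLocallyFiniteOrder (α := V)
  refine monotone_iff_forall_covBy f |>.2 fun u v huv => ?_
  rcases hadj u v huv with heq | hcov | hcov
  · exact heq.le
  · exact hcov.le
  · obtain ⟨w, hvw, hw⟩ := exists_ge_of_map_le hadj htop hcov.le
    exact ((hfib (f u)).out rfl hw ⟨huv.le, hvw⟩).ge

theorem exists_galoisInsertion_of_adj [IsTreeOrder W]
    (hadj : ∀ u v, u ⋖ v → f u = f v ∨ (hasse W).Adj (f u) (f v)) (htop : f ⊤ = ⊤)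
    (hfib : ∀ b, (f ⁻¹' {b}).OrdConnected) (hdir : ∀ b, DirectedOn (· ≤ ·) (f ⁻¹' {b}))
    (hsurj : f.Surjective) : ∃ g : W → V, Nonempty (GaloisInsertion f g) := by
  have hgreatest (b : W) : ∃ v, IsGreatest (f ⁻¹' {b}) v := by
    obtain ⟨v, hv, hmax⟩ := (f ⁻¹' {b}).toFinite.exists_maximal (hsurj b)
    refine ⟨v, hv, fun u hu => ?_⟩
    obtain ⟨w, hw, huw, hvw⟩ := hdir b u hu v hv
    exact huw.trans (hmax hw hvw)
  choose g hg using hgreatest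
  have hgc : GaloisConnection f g := fun v b => by
    refine ⟨fun h => ?_, fun h => (monotone_of_adj hadj htop hfib h).trans_eq (hg b).1⟩
    obtain ⟨w, hvw, hw⟩ := exists_ge_of_map_le hadj htop h
    exact hvw.trans ((hg b).2 hw)
  exact ⟨g, ⟨hgc.toGaloisInsertion fun b => ((hg b).1 : f (g b) = b).ge⟩⟩

theorem ordConnected_preimage_singleton {V W : Type*} [PartialOrder V] {f : V → W}
    (hf : f.Injective) (b : W) : (f ⁻¹' {b}).OrdConnected :=
  ⟨fun _ hu _ hw _ hv => (hv.1.antisymm (hv.2.trans_eq (hf (hw.trans hu.symm)))) ▸ hu⟩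

theorem le_iff_le_of_hasseIso [IsTreeOrder V] [IsTreeOrder W] (e : hasse V ≃g hasse W)
    (htop : e ⊤ = ⊤) {u v : V} : e u ≤ e v ↔ u ≤ v := by
  have : Finite W := .of_equiv V e.toEquiv
  have hmono : Monotone e := monotone_of_adj
    (fun u v h => Or.inr (e.map_adj_iff.2 (Or.inl h))) htop
    (ordConnected_preimage_singleton e.injective)
  have hmono' : Monotone e.symm := monotone_of_adj
    (fun u v h => Or.inr (e.symm.map_adj_iff.2 (Or.inl h))) (htop ▸ e.symm_apply_apply ⊤)
    (ordConnected_preimage_singleton e.symm.injective)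
  exact ⟨fun h => by simpa using hmono' h, fun h => hmono h⟩

end TreeMap

/-- The edges of the Hasse diagram that are contracted by `f`. -/
def contractedEdges {V W : Type*} [PartialOrder V] (f : V → W) : Set (Sym2 V) :=
  {e ∈ (hasse V).edgeSet | (e.map f).IsDiag}

theorem fromEdgeSet_contractedEdges_adj {V W : Type*} [PartialOrder V] {f : V → W}
    {u v : V} :
    (fromEdgeSet (contractedEdges f)).Adj u v ↔ (hasse V).Adj u v ∧ f u = f v := by
  rw [fromEdgeSet_adj]
  exact ⟨And.left, fun h => ⟨h, h.1.ne⟩⟩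

section TreeGaloisInsertion

variable {V W : Type*} [PartialOrder V] [Finite V] [PartialOrder W]
  {f : V → W} {g : W → V}

theorem exists_galoisInsertion_of_orderEmbedding [IsTreeOrder V] [OrderTop V] [OrderTop W]
    (g : W ↪o V) (htop : g ⊤ = ⊤) : ∃ f : V → W, Nonempty (GaloisInsertion f g) := by
  have hleast (v : V) : ∃ b, IsLeast {b | v ≤ g b} b := by
    have : Finite W := .of_injective g g.injective
    obtain ⟨b, hb, hmin⟩ := {b | v ≤ g b}.toFinite.exists_minimal ⟨⊤, htop.ge.trans' le_top⟩
    refine ⟨b, hb, fun c hc => ?_⟩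
    refine (le_or_ge_of_le_of_le hb hc).elim g.le_iff_le.1 fun h => hmin hc (g.le_iff_le.1 h)
  choose f hf using hleast
  have hgc : GaloisConnection f g := fun v b =>
    ⟨fun h => (hf v).1.trans (g.monotone h), fun h => (hf v).2 h⟩
  exact ⟨f, ⟨hgc.toGaloisInsertion fun b => g.le_iff_le.1 (hgc.le_u_l (g b))⟩⟩

theorem reachable_contractedEdges_iff (gi : GaloisInsertion f g) {u v : V} :
    (fromEdgeSet (contractedEdges f)).Reachable u v ↔ f u = f v := by
  refine ⟨fun h => ?_, fun h => ?_⟩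
  · obtain ⟨p⟩ := h
    induction p with
    | nil => rfl
    | cons hadj _ ih => exact (fromEdgeSet_contractedEdges_adj.1 hadj).2.trans ih
  · have reachable_g (w : V) : (fromEdgeSet (contractedEdges f)).Reachable w (g (f w)) := by
      induction w using WellFoundedGT.induction with
      | ind w ih =>
        rcases (gi.gc.le_u_l w).eq_or_lt with heq | hlt
        · rw [← heq]
        obtain ⟨w', hcov, hw'⟩ := exists_covBy_le_of_lt hlt
        have hf : f w = f w' := (gi.gc.monotone_l hcov.le).antisymm (gi.gc.l_le hw')
        refine .trans (Adj.reachable ?_) (hf ▸ ih w' hcov.lt)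
        exact fromEdgeSet_contractedEdges_adj.2 ⟨Or.inl hcov, hf⟩
    exact (reachable_g u).trans (h ▸ (reachable_g v).symm)

theorem covBy_iff_exists_of_galoisInsertion [IsTreeOrder V] (gi : GaloisInsertion f g) {a b : W} :
    a ⋖ b ↔ a ≠ b ∧ ∃ u v, f u = a ∧ f v = b ∧ u ⋖ v := by
  constructor
  · intro hab
    have hlt : g a < g b := gi.strictMono_u hab.lt
    obtain ⟨v, hav, hvb⟩ := exists_covBy_le_of_lt hlt
    have hv : a < f v := by
      refine lt_of_le_not_ge ?_ fun h => hav.lt.not_ge (gi.gc.le_u h)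
      exact (gi.l_u_eq a).ge.trans (gi.gc.monotone_l hav.le)
    exact ⟨hab.ne, g a, v, gi.l_u_eq a, (gi.gc.l_le hvb).eq_of_not_lt (hab.2 hv), hav⟩
  · rintro ⟨hne, u, v, rfl, rfl, huv⟩
    refine ⟨(gi.gc.monotone_l huv.le).lt_of_ne hne, fun c huc hcv => hcv.not_ge ?_⟩
    exact gi.gc.l_le (le_of_covBy_of_lt huv ((gi.gc.le_u_l u).trans_lt (gi.strictMono_u huc)))

theorem hasse_adj_iff_exists_of_galoisInsertion [IsTreeOrder V] (gi : GaloisInsertion f g)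
    {a b : W} : (hasse W).Adj a b ↔ a ≠ b ∧ ∃ u v, f u = a ∧ f v = b ∧ (hasse V).Adj u v := by
  refine (or_congr (covBy_iff_exists_of_galoisInsertion gi)
    (covBy_iff_exists_of_galoisInsertion gi)).trans ⟨?_, ?_⟩
  · rintro (⟨hne, u, v, hu, hv, h⟩ | ⟨hne, v, u, hv, hu, h⟩)
    · exact ⟨hne, u, v, hu, hv, Or.inl h⟩
    · exact ⟨hne.symm, u, v, hu, hv, Or.inr h⟩
  · rintro ⟨hne, u, v, hu, hv, h | h⟩
    · exact Or.inl ⟨hne, u, v, hu, hv, h⟩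
    · exact Or.inr ⟨hne.symm, v, u, hv, hu, h⟩

end TreeGaloisInsertion

/-! ## Trees and laminar families -/

/-- A tree family with parameter `k`: a laminar family of sets of size at least `k`, other than the
whole set. For `k = 2`, these are the families of sets of leaf labels below the internal vertices
of a rooted tree. -/
structure IsTreeFamily {n : ℕ} (k : ℕ) (F : Set (Set (Fin n))) : Prop where
  laminar : Laminar F
  le_ncard : ∀ B ∈ F, k ≤ B.ncard
  univ_notMem : Set.univ ∉ F

/-- The sets of leaf labels below all vertices of a rooted tree, in terms of those below the
internal vertices. -/
def hierarchy {n : ℕ} (F : Set (Set (Fin n))) : Set (Set (Fin n)) :=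
  insert Set.univ (Set.range singleton ∪ F)

section Families

variable {n k : ℕ} {F F' : Set (Set (Fin n))} {B : Set (Fin n)}

theorem IsTreeFamily.mono {l : ℕ} (hF : IsTreeFamily k F) (hl : l ≤ k) (hF' : F' ⊆ F) :
    IsTreeFamily l F' where
  laminar B hB C hC := hF.laminar B (hF' hB) C (hF' hC)
  le_ncard B hB := hl.trans (hF.le_ncard B (hF' hB))
  univ_notMem h := hF.univ_notMem (hF' h)

theorem mem_hierarchy_iff_of_two_le (hB : 2 ≤ B.ncard) (hB' : B ≠ Set.univ) :
    B ∈ hierarchy F ↔ B ∈ F := by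
  refine ⟨?_, fun h => Or.inr (Or.inr h)⟩
  rintro (h | ⟨i, rfl⟩ | h)
  · exact (hB' h).elim
  · simp at hB
  · exact h

theorem IsTreeFamily.hierarchy_subset_iff (hF : IsTreeFamily 2 F) :
    hierarchy F ⊆ hierarchy F' ↔ F ⊆ F' := by
  refine ⟨fun h B hB => ?_, fun h => Set.insert_subset_insert (Set.union_subset_union_right _ h)⟩
  refine (mem_hierarchy_iff_of_two_le (hF.le_ncard B hB) ?_).1 (h (Or.inr (Or.inr hB)))
  exact fun h' => hF.univ_notMem (h' ▸ hB)

theorem Laminar.hierarchy (hF : Laminar F) : Laminar (hierarchy F) := by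
  have comparable_singleton (i : Fin n) (C : Set (Fin n)) :
      {i} ⊆ C ∨ C ⊆ {i} ∨ Disjoint {i} C := by
    by_cases hi : i ∈ C
    · exact Or.inl (Set.singleton_subset_iff.2 hi)
    · exact Or.inr (Or.inr (Set.disjoint_singleton_left.2 hi))
  rintro B (rfl | ⟨i, rfl⟩ | hB) C (rfl | ⟨j, rfl⟩ | hC)
  · exact Or.inl le_rfl
  · exact Or.inr (Or.inl (Set.subset_univ _))
  · exact Or.inr (Or.inl (Set.subset_univ _))
  · exact Or.inl (Set.subset_univ _)
  · exact comparable_singleton i {j}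
  · exact comparable_singleton i C
  · exact Or.inl (Set.subset_univ _)
  · rcases comparable_singleton j B with h | h | h
    exacts [Or.inr (Or.inl h), Or.inl h, Or.inr (Or.inr h.symm)]
  · exact hF B hB C hC

end Families

namespace LabelledTree

variable {n : ℕ} {T T' : LabelledTree n}

instance (T : LabelledTree n) : Finite T.V := T.finite

instance (T : LabelledTree n) : PartialOrder T.V := rootedOrder T.isTree T.root

instance (T : LabelledTree n) : IsTreeOrder T.V := isTreeOrder_rootedOrder T.isTree T.root

instance (T : LabelledTree n) : OrderTop T.V where
  top := T.root
  le_top := rootedLE_root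

theorem hasse_eq_graph (T : LabelledTree n) : hasse T.V = T.graph :=
  hasse_rootedOrder T.isTree T.root

theorem isLeaf_iff {v : T.V} : T.IsLeaf v ↔ ((hasse T.V).neighborSet v).ncard = 1 := by
  rw [hasse_eq_graph]
  exact Set.ext_iff.1 T.range_leaf v

theorem children_eq (v : T.V) : T.children v = {w | w ⋖ v} := by
  ext w
  rw [children, ← hasse_eq_graph]
  refine ⟨fun h => h.1.resolve_left fun hvw => h.2 hvw.le, fun h => ⟨Or.inr h, ?_⟩⟩
  exact h.lt.not_ge

theorem two_le_ncard_covBy {v : T.V} (hv : ¬ T.IsLeaf v) : 2 ≤ {w | w ⋖ v}.ncard := by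
  rcases eq_or_ne v ⊤ with rfl | htop
  · rw [← ncard_neighborSet_top, hasse_eq_graph]
    exact T.two_le_degree_root
  · have := T.three_le_degree v hv htop
    rw [← hasse_eq_graph, ncard_neighborSet_of_ne_top htop] at this
    exact Nat.le_of_succ_le_succ this

theorem IsLeaf.isMin {v : T.V} (hv : T.IsLeaf v) : IsMin v := by
  intro w hwv
  by_contra h
  obtain ⟨c, -, hc⟩ := exists_le_covBy_of_lt (lt_of_le_not_ge hwv h)
  have hdeg := isLeaf_iff.1 hv
  have hpos : 0 < {w | w ⋖ v}.ncard := (Set.ncard_pos).2 ⟨c, hc⟩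
  rcases eq_or_ne v ⊤ with rfl | htop
  · have := T.two_le_degree_root
    rw [← hasse_eq_graph] at this
    exact absurd hdeg (Nat.ne_of_gt this)
  · rw [ncard_neighborSet_of_ne_top htop] at hdeg
    lia

theorem leavesBelow_mono : Monotone T.leavesBelow := fun _ _ h _ hi => le_trans hi h

theorem mem_leavesBelow {i : Fin n} {v : T.V} : i ∈ T.leavesBelow v ↔ T.leaf i ≤ v := Iff.rfl

theorem leavesBelow_nonempty (v : T.V) : (T.leavesBelow v).Nonempty := by
  induction v using WellFoundedLT.induction with
  | ind v ih =>
    by_cases hv : T.IsLeaf v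
    · obtain ⟨i, rfl⟩ := hv
      exact ⟨i, mem_leavesBelow.2 le_rfl⟩
    · have hpos : {w | w ⋖ v}.ncard ≠ 0 := Nat.ne_zero_of_lt (two_le_ncard_covBy hv)
      obtain ⟨c, hc⟩ := Set.nonempty_of_ncard_ne_zero hpos
      exact (ih c hc.lt).mono (leavesBelow_mono hc.le)

theorem disjoint_leavesBelow {v w : T.V} (hvw : ¬ v ≤ w) (hwv : ¬ w ≤ v) :
    Disjoint (T.leavesBelow v) (T.leavesBelow w) :=
  Set.disjoint_left.2 fun _ hv hw => (le_or_ge_of_le_of_le hv hw).elim hvw hwv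

theorem disjoint_leavesBelow_of_covBy {v c d : T.V} (hc : c ⋖ v) (hd : d ⋖ v) (hcd : c ≠ d) :
    Disjoint (T.leavesBelow c) (T.leavesBelow d) :=
  disjoint_leavesBelow (fun h => hc.2 (h.lt_of_ne hcd) hd.lt)
    fun h => hd.2 (h.lt_of_ne hcd.symm) hc.lt

theorem exists_covBy_ne {v c : T.V} (hc : c ⋖ v) : ∃ d, d ⋖ v ∧ d ≠ c := by
  have hv : ¬ T.IsLeaf v := fun h => hc.lt.not_ge (h.isMin hc.le)
  obtain ⟨d, hd, hdc⟩ := Set.exists_ne_of_one_lt_ncard (two_le_ncard_covBy hv) c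
  exact ⟨d, hd, hdc⟩

theorem leavesBelow_subset_leavesBelow_iff {v w : T.V} :
    T.leavesBelow v ⊆ T.leavesBelow w ↔ v ≤ w := by
  refine ⟨fun h => ?_, fun h => leavesBelow_mono h⟩
  obtain ⟨i, hi⟩ := leavesBelow_nonempty v
  refine (le_or_ge_of_le_of_le hi (h hi)).elim id fun hwv => ?_
  by_contra hvw
  obtain ⟨c, hwc, hcv⟩ := exists_le_covBy_of_lt (lt_of_le_not_ge hwv hvw)
  obtain ⟨d, hdv, hdc⟩ := exists_covBy_ne hcv
  refine (leavesBelow_nonempty d).not_subset_empty fun j hj => ?_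
  exact (disjoint_leavesBelow_of_covBy hdv hcv hdc).le_bot
    ⟨hj, leavesBelow_mono hwc (h (leavesBelow_mono hdv.le hj))⟩

/-- A vertex of a rooted tree is determined by the set of labels of the leaves below it. -/
def leavesBelowEmbedding (T : LabelledTree n) : T.V ↪o Set (Fin n) :=
  OrderEmbedding.ofMapLEIff T.leavesBelow fun _ _ => leavesBelow_subset_leavesBelow_iff

theorem leavesBelow_injective : T.leavesBelow.Injective := T.leavesBelowEmbedding.injective

theorem leavesBelow_top : T.leavesBelow ⊤ = Set.univ :=
  Set.eq_univ_of_forall fun _ => mem_leavesBelow.2 le_top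

theorem leavesBelow_leaf (i : Fin n) : T.leavesBelow (T.leaf i) = {i} := by
  ext j
  have hmin : IsMin (T.leaf i) := IsLeaf.isMin ⟨i, rfl⟩
  rw [mem_leavesBelow, Set.mem_singleton_iff, ← T.leaf_injective.eq_iff]
  exact ⟨fun h => hmin.eq_of_le h, le_of_eq⟩

theorem two_le_ncard_leavesBelow {v : T.V} (hv : ¬ T.IsLeaf v) : 2 ≤ (T.leavesBelow v).ncard := by
  obtain ⟨c, d, hc, hd, hcd⟩ := (Set.one_lt_ncard_iff).1 (two_le_ncard_covBy hv)
  obtain ⟨i, hi⟩ := leavesBelow_nonempty c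
  obtain ⟨j, hj⟩ := leavesBelow_nonempty d
  refine (Set.one_lt_ncard_iff).2 ⟨i, j, leavesBelow_mono hc.le hi, leavesBelow_mono hd.le hj, ?_⟩
  rintro rfl
  exact (disjoint_leavesBelow_of_covBy hc hd hcd).le_bot ⟨hi, hj⟩

/-- The sets of labels of the leaves below the internal vertices. -/
def clusters (T : LabelledTree n) : Set (Set (Fin n)) := T.leavesBelow '' {v | T.IsInternal v}

theorem range_leavesBelow (T : LabelledTree n) :
    Set.range T.leavesBelow = hierarchy T.clusters := by
  ext B
  constructor
  · rintro ⟨v, rfl⟩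
    rcases eq_or_ne v ⊤ with rfl | htop
    · exact Or.inl leavesBelow_top
    by_cases hv : T.IsLeaf v
    · obtain ⟨i, rfl⟩ := hv
      exact Or.inr (Or.inl ⟨i, (leavesBelow_leaf i).symm⟩)
    · exact Or.inr (Or.inr ⟨v, ⟨hv, htop⟩, rfl⟩)
  · rintro (rfl | ⟨i, rfl⟩ | ⟨v, -, rfl⟩)
    exacts [⟨⊤, leavesBelow_top⟩, ⟨T.leaf i, leavesBelow_leaf i⟩, ⟨v, rfl⟩]

theorem laminar_clusters (T : LabelledTree n) : Laminar T.clusters := by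
  rintro _ ⟨v, -, rfl⟩ _ ⟨w, -, rfl⟩
  by_cases hvw : v ≤ w
  · exact Or.inl (leavesBelow_mono hvw)
  by_cases hwv : w ≤ v
  · exact Or.inr (Or.inl (leavesBelow_mono hwv))
  · exact Or.inr (Or.inr (disjoint_leavesBelow hvw hwv))

theorem isTreeFamily_clusters (T : LabelledTree n) : IsTreeFamily 2 T.clusters where
  laminar := T.laminar_clusters
  le_ncard := by
    rintro _ ⟨v, hv, rfl⟩
    exact two_le_ncard_leavesBelow hv.1
  univ_notMem := by
    rintro ⟨v, hv, h⟩
    exact hv.2 (leavesBelow_injective (h.trans leavesBelow_top.symm))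

theorem clusters_subset_clusters_iff :
    T'.clusters ⊆ T.clusters ↔ Set.range T'.leavesBelow ⊆ Set.range T.leavesBelow := by
  rw [range_leavesBelow, range_leavesBelow, T'.isTreeFamily_clusters.hierarchy_subset_iff]

theorem range_leavesBelow_subset_of_galoisInsertion {f : T.V → T'.V} {g : T'.V → T.V}
    (gi : GaloisInsertion f g) (hleaf : ∀ i, f (T.leaf i) = T'.leaf i) :
    Set.range T'.leavesBelow ⊆ Set.range T.leavesBelow := by
  rintro _ ⟨b, rfl⟩
  refine ⟨g b, ?_⟩
  ext i
  rw [mem_leavesBelow, mem_leavesBelow, ← gi.gc, hleaf]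

theorem IsContraction.clusters_subset (h : T.IsContraction T') : T'.clusters ⊆ T.clusters := by
  obtain ⟨E, hE, f, hsurj, hfib, hadj, htop, hleaf⟩ := h
  have hle : fromEdgeSet E ≤ hasse T.V := by
    rw [hasse_eq_graph, ← fromEdgeSet_edgeSet T.graph]
    exact fromEdgeSet_mono fun e he => (hE he).1
  rw [← hasse_eq_graph] at hadj
  have hadj' (u v : T.V) (huv : u ⋖ v) : f u = f v ∨ (hasse T'.V).Adj (f u) (f v) :=
    or_iff_not_imp_left.2 fun hne =>
      (hadj _ _).2 ⟨hne, u, v, rfl, rfl, T.hasse_eq_graph ▸ Or.inl huv⟩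
  have hconn (b : T'.V) : (f ⁻¹' {b}).OrdConnected := by
    refine ⟨fun u hu w hw v hv => ?_⟩
    have hreach := (hfib u w).1 (hu.trans hw.symm)
    exact ((hfib u v).2 (reachable_of_le_of_not_lt hle hreach hv.1 hv.2.not_gt)).symm.trans hu
  have hdir (b : T'.V) : DirectedOn (· ≤ ·) (f ⁻¹' {b}) := fun u hu v hv => by
    obtain ⟨w, huw, hvw, hreach⟩ := exists_le_of_reachable hle ((hfib u v).1 (hu.trans hv.symm))
    exact ⟨w, ((hfib u w).2 hreach).symm.trans hu, huw, hvw⟩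
  obtain ⟨g, ⟨gi⟩⟩ := exists_galoisInsertion_of_adj hadj' htop hconn hdir hsurj
  exact clusters_subset_clusters_iff.2 (range_leavesBelow_subset_of_galoisInsertion gi hleaf)

theorem exists_orderEmbedding (h : Set.range T'.leavesBelow ⊆ Set.range T.leavesBelow) :
    ∃ g : T'.V ↪o T.V, ∀ b, T.leavesBelow (g b) = T'.leavesBelow b := by
  choose g hg using fun b => h ⟨b, rfl⟩
  refine ⟨OrderEmbedding.ofMapLEIff g fun a b => ?_, hg⟩
  rw [← leavesBelow_subset_leavesBelow_iff, hg, hg, leavesBelow_subset_leavesBelow_iff]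

theorem isContraction_of_clusters_subset (h : T'.clusters ⊆ T.clusters) : T.IsContraction T' := by
  obtain ⟨g, hg⟩ := exists_orderEmbedding (clusters_subset_clusters_iff.1 h)
  have htop : g ⊤ = ⊤ := leavesBelow_injective <| by rw [hg, leavesBelow_top, leavesBelow_top]
  have hleaf (i : Fin n) : g (T'.leaf i) = T.leaf i :=
    leavesBelow_injective <| by rw [hg, leavesBelow_leaf, leavesBelow_leaf]
  obtain ⟨f, ⟨gi⟩⟩ := exists_galoisInsertion_of_orderEmbedding g htop
  have hf_leaf (i : Fin n) : f (T.leaf i) = T'.leaf i := by rw [← hleaf, gi.l_u_eq]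
  have eq_leaf {i : Fin n} {v : T.V} (hv : f v = T'.leaf i) : v = T.leaf i := by
    have hmin : IsMin (T.leaf i) := IsLeaf.isMin ⟨i, rfl⟩
    exact hmin.eq_of_le (hleaf i ▸ gi.gc.le_u hv.le)
  refine ⟨contractedEdges f, fun e he => ⟨T.hasse_eq_graph ▸ he.1, ?_⟩, f, gi.l_surjective,
    fun u v => (reachable_contractedEdges_iff gi).symm, ?_,
    (congrArg f htop).symm.trans (gi.l_u_eq ⊤), hf_leaf⟩
  · rintro _ hmem ⟨i, rfl⟩
    obtain ⟨v, rfl⟩ := hmem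
    exact (mem_edgeSet _ |>.1 he.1).ne (eq_leaf (he.2.symm.trans (hf_leaf i))).symm
  · intro a b
    rw [← hasse_eq_graph, ← hasse_eq_graph]
    exact hasse_adj_iff_exists_of_galoisInsertion gi

theorem isContraction_iff : T.IsContraction T' ↔ T'.clusters ⊆ T.clusters :=
  ⟨IsContraction.clusters_subset, isContraction_of_clusters_subset⟩

theorem clusters_subset_of_equiv (h : T ≈ T') : T'.clusters ⊆ T.clusters := by
  obtain ⟨f, htop, hleaf⟩ := h
  let e : hasse T.V ≃g hasse T'.V :=
    ⟨f.toEquiv, by rw [hasse_eq_graph, hasse_eq_graph]; exact f.map_rel_iff⟩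
  let o : T.V ≃o T'.V := ⟨f.toEquiv, le_iff_le_of_hasseIso e htop⟩
  exact clusters_subset_clusters_iff.2
    (range_leavesBelow_subset_of_galoisInsertion o.toGaloisInsertion hleaf)

theorem equiv_of_clusters_eq (h : T'.clusters = T.clusters) : T ≈ T' := by
  have hrange : Set.range T'.leavesBelow = Set.range T.leavesBelow := by
    rw [range_leavesBelow, range_leavesBelow, h]
  obtain ⟨g, hg⟩ := exists_orderEmbedding hrange.ge
  have hsurj : Function.Surjective g := fun b => by
    obtain ⟨v, hv⟩ : T'.leavesBelow b ∈ Set.range T.leavesBelow := hrange ▸ ⟨b, rfl⟩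
    exact ⟨v, leavesBelow_injective ((hg v).trans hv)⟩
  let o : T.V ≃o T'.V := RelIso.ofSurjective g hsurj
  refine ⟨⟨o.toEquiv, fun {u v} => ?_⟩, map_top o, fun i => leavesBelow_injective ?_⟩
  · rw [← hasse_eq_graph, ← hasse_eq_graph]
    exact or_congr (apply_covBy_apply_iff o) (apply_covBy_apply_iff o)
  · exact (hg _).trans (by rw [leavesBelow_leaf, leavesBelow_leaf])

theorem equiv_iff : T ≈ T' ↔ T.clusters = T'.clusters :=
  ⟨fun h => (clusters_subset_of_equiv (Setoid.symm h)).antisymm (clusters_subset_of_equiv h),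
    fun h => equiv_of_clusters_eq h.symm⟩

theorem ncard_internalEdges (T : LabelledTree n) : T.internalEdges.ncard = T.clusters.ncard := by
  rw [clusters, Set.ncard_image_of_injective _ leavesBelow_injective]
  have hparent (v : T.V) (hv : T.IsInternal v) : ∃ p, v ⋖ p :=
    (exists_covBy_le_of_lt (lt_top_iff_ne_top.2 hv.2)).imp fun _ => And.left
  choose! parent hparent using hparent
  have hedges : T.internalEdges = (fun v => s(v, parent v)) '' {v | T.IsInternal v} := by
    ext e
    constructor
    · have eq_of_covBy {v w : T.V} (hvw : v ⋖ w) (hv : ¬ T.IsLeaf v) :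
          T.IsInternal v ∧ s(v, parent v) = s(v, w) := by
        have hinternal : T.IsInternal v := ⟨hv, hvw.lt.ne_top⟩
        exact ⟨hinternal, by rw [covBy_unique (hparent v hinternal) hvw]⟩
      induction e with | h v w
      rintro ⟨hadj, hleaf⟩
      rw [mem_edgeSet, ← hasse_eq_graph] at hadj
      rcases hadj with h | h
      · exact ⟨v, eq_of_covBy h (hleaf v (Sym2.mem_mk_left v w))⟩
      · exact ⟨w, Sym2.eq_swap (a := v) ▸ eq_of_covBy h (hleaf w (Sym2.mem_mk_right v w))⟩
    · rintro ⟨v, hv, rfl⟩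
      refine ⟨(mem_edgeSet _).2 (T.hasse_eq_graph ▸ Or.inl (hparent v hv)), fun w hw => ?_⟩
      rcases Sym2.mem_iff.1 hw with rfl | rfl
      · exact hv.1
      · exact fun hleaf => (hparent v hv).lt.not_ge (hleaf.isMin (hparent v hv).le)
  rw [hedges]
  refine Set.InjOn.ncard_image fun u hu v hv huv => ?_
  rcases Sym2.eq_iff.1 huv with h | ⟨hup, hvp⟩
  · exact h.1
  · exact ((hup ▸ (hparent v hv).lt).not_gt (hvp ▸ (hparent u hu).lt)).elim

end LabelledTree

section Realization

variable {n : ℕ} {F : Set (Set (Fin n))}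

theorem IsTreeFamily.nonempty_of_mem_hierarchy (hF : IsTreeFamily 2 F) [NeZero n] {B : Set (Fin n)}
    (hB : B ∈ hierarchy F) : B.Nonempty := by
  rcases hB with rfl | ⟨i, rfl⟩ | hB
  · exact Set.univ_nonempty
  · exact Set.singleton_nonempty i
  · exact Set.nonempty_of_ncard_ne_zero (Nat.ne_zero_of_lt (hF.le_ncard B hB))

theorem IsTreeFamily.isTreeOrder_hierarchy (hF : IsTreeFamily 2 F) [NeZero n] :
    IsTreeOrder (hierarchy F) where
  le_or_ge_of_le_of_le {B C D} hBC hBD := by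
    rcases hF.laminar.hierarchy C C.2 D D.2 with h | h | h
    · exact Or.inl h
    · exact Or.inr h
    · exact ((hF.nonempty_of_mem_hierarchy B.2).not_subset_empty
        ((Set.subset_inter hBC hBD).trans h.le_bot)).elim

instance : OrderTop (hierarchy F) where
  top := ⟨Set.univ, Or.inl rfl⟩
  le_top B := Set.subset_univ B.1

/-- The leaf with label `i` of the tree with hierarchy `hierarchy F`. -/
def singletonCluster (F : Set (Set (Fin n))) (i : Fin n) : hierarchy F :=
  ⟨{i}, Or.inr (Or.inl ⟨i, rfl⟩)⟩

theorem singletonCluster_le_iff {i : Fin n} {B : hierarchy F} :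
    singletonCluster F i ≤ B ↔ i ∈ B.1 := Set.singleton_subset_iff

theorem IsTreeFamily.two_le_ncard_or_mem_range (hF : IsTreeFamily 2 F) (hn : 2 ≤ n)
    (B : hierarchy F) : 2 ≤ B.1.ncard ∨ B ∈ Set.range (singletonCluster F) := by
  rcases B with ⟨B, rfl | ⟨i, rfl⟩ | hB⟩
  · exact Or.inl (by rwa [Set.ncard_univ, Nat.card_fin])
  · exact Or.inr ⟨i, rfl⟩
  · exact Or.inl (hF.le_ncard B hB)

theorem two_le_ncard_covBy_hierarchy {B : hierarchy F} (hB : 2 ≤ B.1.ncard) :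
    2 ≤ {C | C ⋖ B}.ncard := by
  have exists_child {i : Fin n} (hi : i ∈ B.1) : ∃ C, i ∈ C.1 ∧ C ⋖ B := by
    have hlt : singletonCluster F i < B := by
      refine (singletonCluster_le_iff.2 hi).lt_of_ne ?_
      rintro rfl
      simp [singletonCluster] at hB
    obtain ⟨C, hC, hCB⟩ := exists_le_covBy_of_lt hlt
    exact ⟨C, singletonCluster_le_iff.1 hC, hCB⟩
  obtain ⟨i, hi⟩ := Set.nonempty_of_ncard_ne_zero (Nat.ne_zero_of_lt hB)
  obtain ⟨C, -, hCB⟩ := exists_child hi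
  obtain ⟨j, hj, hjC⟩ := Set.exists_of_ssubset hCB.lt
  obtain ⟨D, hjD, hDB⟩ := exists_child hj
  exact (Set.one_lt_ncard_iff).2 ⟨C, D, hCB, hDB, fun h => hjC (h ▸ hjD)⟩

theorem IsTreeFamily.isMin_singletonCluster (hF : IsTreeFamily 2 F) [NeZero n] (i : Fin n) :
    IsMin (singletonCluster F i) := fun C hC => by
  obtain ⟨j, hj⟩ := hF.nonempty_of_mem_hierarchy C.2
  exact singletonCluster_le_iff.2 (Set.mem_singleton_iff.1 (hC hj) ▸ hj)

theorem IsTreeFamily.ncard_neighborSet_eq_one_iff (hF : IsTreeFamily 2 F) (hn : 2 ≤ n)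
    {B : hierarchy F} :
    ((hasse (hierarchy F)).neighborSet B).ncard = 1 ↔ B ∈ Set.range (singletonCluster F) := by
  have : NeZero n := ⟨Nat.ne_zero_of_lt hn⟩
  have := hF.isTreeOrder_hierarchy
  constructor
  · intro hdeg
    refine (hF.two_le_ncard_or_mem_range hn B).resolve_left fun hB => ?_
    have hchildren := two_le_ncard_covBy_hierarchy hB
    rcases eq_or_ne B ⊤ with rfl | htop
    · rw [ncard_neighborSet_top] at hdeg
      lia
    · rw [ncard_neighborSet_of_ne_top htop] at hdeg
      lia
  · rintro ⟨i, rfl⟩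
    have htop : singletonCluster F i ≠ ⊤ := fun h => by
      have hcard := congrArg (fun B : hierarchy F => B.1.ncard) h
      simp only [singletonCluster, Set.ncard_singleton] at hcard
      have := hcard.trans (Set.ncard_univ _)
      rw [Nat.card_fin] at this
      lia
    have hchildren : {C | C ⋖ singletonCluster F i} = ∅ :=
      Set.eq_empty_of_forall_notMem fun C hC => hC.lt.not_ge (hF.isMin_singletonCluster i hC.le)
    rw [ncard_neighborSet_of_ne_top htop, hchildren, Set.ncard_empty]

/-- The tree whose vertices are the members of the hierarchy of a tree family, ordered by
inclusion. -/
def IsTreeFamily.tree (hF : IsTreeFamily 2 F) (hn : 2 ≤ n) : LabelledTree n :=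
  have : NeZero n := ⟨Nat.ne_zero_of_lt hn⟩
  have := hF.isTreeOrder_hierarchy
  have two_le_children {B : hierarchy F} (hB : B ∉ Set.range (singletonCluster F)) :
      2 ≤ {C | C ⋖ B}.ncard :=
    two_le_ncard_covBy_hierarchy ((hF.two_le_ncard_or_mem_range hn B).resolve_right hB)
  { V := hierarchy F
    finite := inferInstance
    graph := hasse (hierarchy F)
    isTree := isTree_hasse
    root := ⊤
    leaf := singletonCluster F
    leaf_injective _ _ h := Set.singleton_injective (congrArg Subtype.val h)
    range_leaf := Set.ext fun _ => (hF.ncard_neighborSet_eq_one_iff hn).symm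
    two_le_degree_root := ncard_neighborSet_top (V := hierarchy F) ▸
      two_le_ncard_covBy_hierarchy (hn.trans_eq ((Set.ncard_univ _).trans (Nat.card_fin n)).symm)
    three_le_degree _ hB htop := ncard_neighborSet_of_ne_top htop ▸
      Nat.succ_le_succ (two_le_children hB) }

theorem IsTreeFamily.clusters_tree (hF : IsTreeFamily 2 F) (hn : 2 ≤ n) :
    (hF.tree hn).clusters = F := by
  have : NeZero n := ⟨Nat.ne_zero_of_lt hn⟩
  have := hF.isTreeOrder_hierarchy
  have hbelow (B : hierarchy F) : (hF.tree hn).leavesBelow B = B.1 :=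
    Set.ext fun _ => rootedLE_hasse.trans singletonCluster_le_iff
  have hrange : Set.range (hF.tree hn).leavesBelow = hierarchy F :=
    (congrArg Set.range (funext hbelow)).trans Subtype.range_coe
  rw [LabelledTree.range_leavesBelow] at hrange
  exact ((hF.tree hn).isTreeFamily_clusters.hierarchy_subset_iff.1 hrange.le).antisymm
    (hF.hierarchy_subset_iff.1 hrange.ge)

end Realization

/-! ## Maximal families -/

namespace LabelledTree

variable {n k : ℕ} {T : LabelledTree n} {v : T.V}

theorem exists_covBy_of_mem_leavesBelow {i : Fin n} (hv : ¬ T.IsLeaf v)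
    (hi : i ∈ T.leavesBelow v) : ∃ c, c ⋖ v ∧ i ∈ T.leavesBelow c := by
  have hlt : T.leaf i < v := (mem_leavesBelow.1 hi).lt_of_ne fun h => hv ⟨i, h⟩
  obtain ⟨c, hic, hcv⟩ := exists_le_covBy_of_lt hlt
  exact ⟨c, hcv, hic⟩

theorem exists_isPreleaf_le (hv : ¬ T.IsLeaf v) : ∃ u ≤ v, T.IsPreleaf u := by
  obtain ⟨u, huv, hu⟩ := {u | ¬ T.IsLeaf u}.toFinite.exists_le_minimal hv
  refine ⟨u, huv, hu.prop, fun w hw => not_not.1 fun hleaf => ?_⟩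
  rw [children_eq] at hw
  exact hu.not_prop_of_lt hw.lt hleaf

theorem IsPreleaf.children_eq_image (hv : T.IsPreleaf v) :
    T.children v = T.leaf '' T.leavesBelow v := by
  refine Set.Subset.antisymm (fun w hw => ?_) ?_
  · obtain ⟨i, rfl⟩ := hv.2 w hw
    rw [children_eq] at hw
    exact ⟨i, hw.le, rfl⟩
  · rintro _ ⟨i, hi, rfl⟩
    obtain ⟨c, hcv, hic⟩ := exists_covBy_of_mem_leavesBelow hv.1 hi
    rw [children_eq]
    obtain ⟨j, rfl⟩ := hv.2 c (children_eq v ▸ hcv)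
    rw [leavesBelow_leaf, Set.mem_singleton_iff] at hic
    exact hic ▸ hcv

theorem IsPreleaf.outdegree_eq (hv : T.IsPreleaf v) :
    T.outdegree v = (T.leavesBelow v).ncard := by
  rw [outdegree, hv.children_eq_image, Set.ncard_image_of_injective _ T.leaf_injective]

theorem IsKEqualBinary.le_ncard_leavesBelow (hT : T.IsKEqualBinary k) (hv : ¬ T.IsLeaf v) :
    k ≤ (T.leavesBelow v).ncard := by
  obtain ⟨u, huv, hu⟩ := exists_isPreleaf_le hv
  rw [← (hT u hu.1).1 hu, hu.outdegree_eq]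
  exact Set.ncard_le_ncard (leavesBelow_mono huv)

theorem IsKEqualBinary.mem_range_leavesBelow (hT : T.IsKEqualBinary k) (hk : 2 ≤ k)
    {B : Set (Fin n)} (hB : k ≤ B.ncard)
    (hlam : ∀ v, B ⊆ T.leavesBelow v ∨ T.leavesBelow v ⊆ B ∨ Disjoint B (T.leavesBelow v)) :
    B ∈ Set.range T.leavesBelow := by
  obtain ⟨v, hv⟩ := {v | B ⊆ T.leavesBelow v}.toFinite.exists_minimal
    ⟨⊤, (Set.subset_univ B).trans_eq leavesBelow_top.symm⟩
  have hBv : B ⊆ T.leavesBelow v := hv.prop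
  have hcard : k ≤ (T.leavesBelow v).ncard := hB.trans (Set.ncard_le_ncard hBv)
  have hleaf : ¬ T.IsLeaf v := by
    rintro ⟨i, rfl⟩
    rw [leavesBelow_leaf, Set.ncard_singleton] at hcard
    lia
  have not_subset {c : T.V} (hc : c ⋖ v) : ¬ B ⊆ T.leavesBelow c := hv.not_prop_of_lt hc.lt
  have exists_child {i : Fin n} (hi : i ∈ B) :
      ∃ c, c ⋖ v ∧ i ∈ T.leavesBelow c ∧ T.leavesBelow c ⊆ B := by
    obtain ⟨c, hc, hic⟩ := exists_covBy_of_mem_leavesBelow hleaf (hBv hi)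
    refine ⟨c, hc, hic, ((hlam c).resolve_left (not_subset hc)).resolve_right ?_⟩
    exact Set.not_disjoint_iff.2 ⟨i, hi, hic⟩
  refine ⟨v, Set.Subset.antisymm ?_ hBv⟩
  by_cases hpre : T.IsPreleaf v
  · refine (Set.eq_of_subset_of_ncard_le hBv ?_).ge
    rwa [← hpre.outdegree_eq, (hT v hleaf).1 hpre]
  · obtain ⟨i, hi⟩ := Set.nonempty_of_ncard_ne_zero (Nat.ne_zero_of_lt (hk.trans hB))
    obtain ⟨c, hc, -, hcB⟩ := exists_child hi
    obtain ⟨j, hj, hjc⟩ := Set.not_subset.1 (not_subset hc)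
    obtain ⟨d, hd, hjd, hdB⟩ := exists_child hj
    have hchildren : {c, d} = {w | w ⋖ v} := by
      refine Set.eq_of_subset_of_ncard_le (Set.pair_subset hc hd) ?_
      have hcd : c ≠ d := by
        rintro rfl
        exact hjc hjd
      rw [← children_eq, Set.ncard_pair hcd]
      exact ((hT v hleaf).2 hpre).le
    intro l hl
    obtain ⟨w, hw, hlw⟩ := exists_covBy_of_mem_leavesBelow hleaf hl
    obtain rfl | rfl : w ∈ ({c, d} : Set T.V) := hchildren ▸ hw
    exacts [hcB hlw, hdB hlw]

theorem leavesBelow_mem_hierarchy (v : T.V) : T.leavesBelow v ∈ hierarchy T.clusters :=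
  T.range_leavesBelow ▸ ⟨v, rfl⟩

theorem IsKEqualBinary.maximal_clusters (hT : T.IsKEqualBinary k) (hk : 2 ≤ k) :
    Maximal (IsTreeFamily k) T.clusters := by
  refine ⟨⟨T.laminar_clusters, ?_, T.isTreeFamily_clusters.univ_notMem⟩, fun F hF hTF B hB => ?_⟩
  · rintro _ ⟨v, hv, rfl⟩
    exact hT.le_ncard_leavesBelow hv.1
  · have hBF : B ∈ hierarchy F := Or.inr (Or.inr hB)
    have hTF' := T.isTreeFamily_clusters.hierarchy_subset_iff.2 hTF
    have hrange : B ∈ Set.range T.leavesBelow :=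
      hT.mem_range_leavesBelow hk (hF.le_ncard B hB) fun v =>
        hF.laminar.hierarchy B hBF _ (hTF' (leavesBelow_mem_hierarchy v))
    rw [range_leavesBelow] at hrange
    refine (mem_hierarchy_iff_of_two_le (hk.trans (hF.le_ncard B hB)) ?_).1 hrange
    rintro rfl
    exact hF.univ_notMem hB

section Merging

variable {S : Set T.V}

theorem biUnion_leavesBelow_comparable (hS : S ⊆ {w | w ⋖ v}) (w : T.V) :
    (⋃ c ∈ S, T.leavesBelow c) ⊆ T.leavesBelow w ∨ T.leavesBelow w ⊆ ⋃ c ∈ S, T.leavesBelow c ∨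
      Disjoint (⋃ c ∈ S, T.leavesBelow c) (T.leavesBelow w) := by
  have hSv : (⋃ c ∈ S, T.leavesBelow c) ⊆ T.leavesBelow v :=
    Set.iUnion₂_subset fun c hc => leavesBelow_mono (hS hc).le
  by_cases hvw : v ≤ w
  · exact Or.inl (hSv.trans (leavesBelow_mono hvw))
  refine Or.inr ?_
  by_cases hwv : w ≤ v
  · obtain ⟨c, hwc, hcv⟩ := exists_le_covBy_of_lt (lt_of_le_not_ge hwv hvw)
    by_cases hc : c ∈ S
    · exact Or.inl ((leavesBelow_mono hwc).trans (Set.subset_biUnion_of_mem hc))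
    · refine Or.inr (Set.disjoint_iUnion₂_left.2 fun d hd => ?_)
      refine (disjoint_leavesBelow_of_covBy (hS hd) hcv ?_).mono_right (leavesBelow_mono hwc)
      exact fun h => hc (h ▸ hd)
  · exact Or.inr ((disjoint_leavesBelow hvw hwv).mono_left hSv)

theorem biUnion_leavesBelow_notMem_range (hS : S ⊂ {w | w ⋖ v}) (hS2 : 2 ≤ S.ncard) :
    ⋃ c ∈ S, T.leavesBelow c ∉ Set.range T.leavesBelow := by
  rintro ⟨w, hw⟩
  have hle {c : T.V} (hc : c ∈ S) : c ≤ w :=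
    leavesBelow_subset_leavesBelow_iff.1 ((Set.subset_biUnion_of_mem hc).trans_eq hw.symm)
  have hwv : w ≤ v := leavesBelow_subset_leavesBelow_iff.1
    (hw.trans_subset (Set.iUnion₂_subset fun c hc => leavesBelow_mono (hS.1 hc).le))
  obtain ⟨c, d, hc, hd, hcd⟩ := (Set.one_lt_ncard_iff).1 hS2
  have hwv' : w = v := by
    refine hwv.eq_of_not_lt fun hlt => hcd ?_
    exact ((hle hc).eq_of_not_lt fun h => (hS.1 hc).2 h hlt).trans
      ((hle hd).eq_of_not_lt fun h => (hS.1 hd).2 h hlt).symm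
  obtain ⟨e, he, heS⟩ := Set.exists_of_ssubset hS
  obtain ⟨i, hi⟩ := leavesBelow_nonempty e
  have hmem : i ∈ ⋃ c ∈ S, T.leavesBelow c := hw ▸ hwv' ▸ leavesBelow_mono he.le hi
  obtain ⟨c, hc, hic⟩ := Set.mem_iUnion₂.1 hmem
  exact (disjoint_leavesBelow_of_covBy (hS.1 hc) he fun h => heS (h ▸ hc)).le_bot ⟨hic, hi⟩

theorem eq_children_of_maximal_clusters (hT : Maximal (IsTreeFamily k) T.clusters)
    (hS : S ⊆ T.children v) (hS2 : 2 ≤ S.ncard)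
    (hcard : k ≤ (⋃ c ∈ S, T.leavesBelow c).ncard) : S = T.children v := by
  rw [children_eq] at hS ⊢
  by_contra hne
  have hrange := biUnion_leavesBelow_notMem_range (hS.ssubset_of_ne hne) hS2
  have hfam : IsTreeFamily k (insert (⋃ c ∈ S, T.leavesBelow c) T.clusters) := by
    refine ⟨T.laminar_clusters.insert ?_, ?_, ?_⟩
    · rintro _ ⟨w, -, rfl⟩
      exact biUnion_leavesBelow_comparable hS w
    · exact Set.forall_mem_insert.2 ⟨hcard, hT.prop.le_ncard⟩
    · rintro (h | h)
      · exact hrange ⟨⊤, leavesBelow_top.trans h⟩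
      · exact hT.prop.univ_notMem h
  obtain ⟨w, -, hw⟩ := hT.le_of_ge hfam (Set.subset_insert _ _) (Set.mem_insert _ _)
  exact hrange ⟨w, hw⟩

end Merging

theorem isKEqualBinary_of_maximal_clusters (hT : Maximal (IsTreeFamily k) T.clusters)
    (hk : 2 ≤ k) (hkn : k ≤ n) : T.IsKEqualBinary k := by
  have le_ncard {v : T.V} (hv : ¬ T.IsLeaf v) : k ≤ (T.leavesBelow v).ncard := by
    rcases eq_or_ne v ⊤ with rfl | htop
    · rwa [leavesBelow_top, Set.ncard_univ, Nat.card_fin]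
    · exact hT.prop.le_ncard _ ⟨v, ⟨hv, htop⟩, rfl⟩
  refine fun v hv => ⟨fun hpre => ?_, fun hpre => ?_⟩
  · obtain ⟨A, hA, hAk⟩ := Set.exists_subset_card_eq (le_ncard hv)
    have hcard : (T.leaf '' A).ncard = k := by
      rw [Set.ncard_image_of_injective _ T.leaf_injective, hAk]
    have hunion : ⋃ c ∈ T.leaf '' A, T.leavesBelow c = A := by
      simp only [Set.biUnion_image, leavesBelow_leaf, Set.biUnion_of_singleton]
    rw [outdegree, ← eq_children_of_maximal_clusters (S := T.leaf '' A) hT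
      (hpre.children_eq_image ▸ Set.image_mono hA) (hk.trans_eq hcard.symm)
      (hAk.ge.trans_eq (congrArg Set.ncard hunion.symm)), hcard]
  · obtain ⟨c, hc, hleaf⟩ : ∃ c ∈ T.children v, ¬ T.IsLeaf c := by
      simpa [IsPreleaf, hv] using hpre
    rw [children_eq] at hc
    obtain ⟨d, hd, hdc⟩ := exists_covBy_ne hc
    have hcard : ({c, d} : Set T.V).ncard = 2 := Set.ncard_pair hdc.symm
    have hunion : T.leavesBelow c ⊆ ⋃ w ∈ ({c, d} : Set T.V), T.leavesBelow w :=
      Set.subset_biUnion_of_mem (Set.mem_insert c {d})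
    rw [outdegree, ← eq_children_of_maximal_clusters (S := {c, d}) hT
      (children_eq v ▸ Set.pair_subset hc hd) hcard.ge
      ((le_ncard hleaf).trans (Set.ncard_le_ncard hunion)), hcard]

theorem isKEqualBinary_iff (hk : 2 ≤ k) (hkn : k ≤ n) :
    T.IsKEqualBinary k ↔ Maximal (IsTreeFamily k) T.clusters :=
  ⟨fun hT => hT.maximal_clusters hk, fun hT => isKEqualBinary_of_maximal_clusters hT hk hkn⟩

end LabelledTree

/-! ## The complex of `k`-equal trees -/

variable {n k : ℕ} {F G : Set (Set (Fin n))}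

theorem isTreeFamily_singleton {B : Set (Fin n)} (hB : k ≤ B.ncard) (hB' : B ≠ Set.univ) :
    IsTreeFamily k {B} where
  laminar := by
    rintro _ rfl _ rfl
    exact Or.inl subset_rfl
  le_ncard := by
    rintro _ rfl
    exact hB
  univ_notMem h := hB' h.symm

theorem LabelledTree.nestedSet_eq_image (T : LabelledTree n) :
    T.nestedSet = blockPartition '' T.clusters := by
  ext π
  constructor
  · rintro ⟨t, ht, rfl⟩
    exact ⟨_, ⟨t, ht, rfl⟩, rfl⟩
  · rintro ⟨_, ⟨t, ht, rfl⟩, rfl⟩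
    exact ⟨t, ht, rfl⟩

namespace TreeType

variable {σ τ μ ν : TreeType n}

/-- The sets of labels of the leaves below the internal vertices of any tree of type `τ`. -/
def clusters (τ : TreeType n) : Set (Set (Fin n)) :=
  Quotient.lift LabelledTree.clusters (fun _ _ => LabelledTree.equiv_iff.1) τ

theorem exists_type_eq (τ : TreeType n) : ∃ T : LabelledTree n, T.type = τ := Quotient.exists_rep τ

theorem clusters_injective : Function.Injective (clusters (n := n)) := by
  intro σ τ h
  obtain ⟨S, rfl⟩ := exists_type_eq σ
  obtain ⟨T, rfl⟩ := exists_type_eq τ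
  exact Quotient.sound (LabelledTree.equiv_iff.2 h)

instance : Finite (TreeType n) := Finite.of_injective clusters clusters_injective

theorem isTreeFamily_clusters (τ : TreeType n) : IsTreeFamily 2 τ.clusters := by
  obtain ⟨T, rfl⟩ := exists_type_eq τ
  exact T.isTreeFamily_clusters

theorem exists_clusters_eq (hn : 2 ≤ n) (hF : IsTreeFamily 2 F) :
    ∃ τ : TreeType n, τ.clusters = F :=
  ⟨(hF.tree hn).type, hF.clusters_tree hn⟩

theorem isContraction_iff : τ.IsContraction σ ↔ σ.clusters ⊆ τ.clusters := by
  constructor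
  · rintro ⟨T, S, rfl, rfl, h⟩
    exact LabelledTree.isContraction_iff.1 h
  · intro h
    obtain ⟨S, rfl⟩ := exists_type_eq σ
    obtain ⟨T, rfl⟩ := exists_type_eq τ
    exact ⟨T, S, rfl, rfl, LabelledTree.isContraction_iff.2 h⟩

theorem hasOneInternalEdge_iff : ν.HasOneInternalEdge ↔ ∃ B, ν.clusters = {B} := by
  constructor
  · rintro ⟨T, rfl, h⟩
    exact Set.ncard_eq_one.1 (T.ncard_internalEdges ▸ h)
  · rintro ⟨B, h⟩
    obtain ⟨T, rfl⟩ := exists_type_eq ν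
    exact ⟨T, rfl, T.ncard_internalEdges.trans (Set.ncard_eq_one.2 ⟨B, h⟩)⟩

/-- The types of the trees whose only internal vertex has leaf set in `F`. -/
def oneEdgeTypes (F : Set (Set (Fin n))) : Set (TreeType n) := {ν | ∃ B ∈ F, ν.clusters = {B}}

theorem vertexSet_eq_oneEdgeTypes (τ : TreeType n) : τ.vertexSet = oneEdgeTypes τ.clusters := by
  ext ν
  constructor
  · rintro ⟨hν, hτ⟩
    obtain ⟨B, hB⟩ := hasOneInternalEdge_iff.1 hν
    rw [isContraction_iff, hB, Set.singleton_subset_iff] at hτ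
    exact ⟨B, hτ, hB⟩
  · rintro ⟨B, hB, hν⟩
    refine ⟨hasOneInternalEdge_iff.2 ⟨B, hν⟩, isContraction_iff.2 ?_⟩
    rwa [hν, Set.singleton_subset_iff]

/-- The set of leaves below the internal vertex of a tree with one internal edge, as a total
function of the type. -/
def cluster (ν : TreeType n) : Set (Fin n) := ⋃₀ ν.clusters

theorem cluster_eq_of_clusters_eq {B : Set (Fin n)} (h : ν.clusters = {B}) : ν.cluster = B := by
  rw [cluster, h, Set.sUnion_singleton]

theorem image_cluster_vertexSet (hn : 2 ≤ n) (τ : TreeType n) :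
    cluster '' τ.vertexSet = τ.clusters := by
  rw [vertexSet_eq_oneEdgeTypes]
  ext B
  constructor
  · rintro ⟨ν, ⟨C, hC, hν⟩, rfl⟩
    rwa [cluster_eq_of_clusters_eq hν]
  · intro hB
    obtain ⟨ν, hν⟩ := exists_clusters_eq hn
      (τ.isTreeFamily_clusters.mono le_rfl (Set.singleton_subset_iff.2 hB))
    exact ⟨ν, ⟨B, hB, hν⟩, cluster_eq_of_clusters_eq hν⟩

theorem vertexSet_subset_iff (hn : 2 ≤ n) :
    σ.vertexSet ⊆ τ.vertexSet ↔ σ.clusters ⊆ τ.clusters := by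
  constructor
  · rw [← image_cluster_vertexSet hn σ, ← image_cluster_vertexSet hn τ]
    exact Set.image_mono
  · rw [vertexSet_eq_oneEdgeTypes, vertexSet_eq_oneEdgeTypes]
    exact fun h ν ⟨B, hB, hν⟩ => ⟨B, h hB, hν⟩

theorem vertexSet_injective (hn : 2 ≤ n) : Function.Injective (vertexSet (n := n)) :=
  fun _ _ h => clusters_injective <| Set.Subset.antisymm
    ((vertexSet_subset_iff hn).1 h.le) ((vertexSet_subset_iff hn).1 h.ge)

theorem mem_maximalTreeTypes (hk : 2 ≤ k) (hkn : k ≤ n) :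
    μ ∈ maximalTreeTypes n k ↔ Maximal (IsTreeFamily k) μ.clusters := by
  constructor
  · rintro ⟨T, rfl, h⟩
    exact (LabelledTree.isKEqualBinary_iff hk hkn).1 h
  · intro h
    obtain ⟨T, rfl⟩ := exists_type_eq μ
    exact ⟨T, rfl, (LabelledTree.isKEqualBinary_iff hk hkn).2 h⟩

theorem mem_kEqualTreeTypes (hk : 2 ≤ k) (hkn : k ≤ n) :
    τ ∈ kEqualTreeTypes n k ↔ IsTreeFamily k τ.clusters := by
  constructor
  · rintro ⟨μ, hμ, h⟩
    exact ((mem_maximalTreeTypes hk hkn).1 hμ).1.mono le_rfl (isContraction_iff.1 h)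
  · intro h
    obtain ⟨M, hle, hM⟩ := (Set.toFinite {F | IsTreeFamily k F}).exists_le_maximal h
    obtain ⟨μ, rfl⟩ := exists_clusters_eq (hk.trans hkn) (hM.1.mono hk subset_rfl)
    exact ⟨μ, (mem_maximalTreeTypes hk hkn).2 hM, isContraction_iff.2 hle⟩

theorem vertexSet_nonempty_of_mem_maximalTreeTypes (hk : 2 ≤ k) (hkn : k < n)
    (hμ : μ ∈ maximalTreeTypes n k) : μ.vertexSet.Nonempty := by
  have hM := (mem_maximalTreeTypes hk hkn.le).1 hμ
  refine Set.Nonempty.of_image (f := cluster) ?_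
  rw [image_cluster_vertexSet (hk.trans hkn.le)]
  by_contra! hempty
  obtain ⟨B, -, hB⟩ := Set.exists_subset_card_eq (s := (Set.univ : Set (Fin n))) (n := k)
    (by simpa [Set.ncard_univ] using hkn.le)
  have hB_univ : B ≠ Set.univ := by
    rintro rfl
    simp [Set.ncard_univ, hkn.ne'] at hB
  have hB_mem := hM.2 (isTreeFamily_singleton hB.ge hB_univ) (hempty ▸ Set.empty_subset _) rfl
  rwa [hempty] at hB_mem

end TreeType

open TreeType

theorem mem_faces_kEqualTreeComplex_iff (hk : 2 ≤ k) (hkn : k ≤ n) {s : Finset (TreeType n)} :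
    s ∈ (kEqualTreeComplex n k).faces ↔
      s.Nonempty ∧ ∃ τ ∈ kEqualTreeTypes n k, (s : Set (TreeType n)) = τ.vertexSet := by
  constructor
  · rintro ⟨hne, μ, hμ, hs⟩
    let F := {B ∈ μ.clusters | ∃ ν ∈ s, ν.clusters = {B}}
    have hμF : IsTreeFamily k μ.clusters := ((mem_maximalTreeTypes hk hkn).1 hμ).1
    have hFk : IsTreeFamily k F := hμF.mono le_rfl (Set.sep_subset _ _)
    obtain ⟨τ, hτ⟩ := exists_clusters_eq (hk.trans hkn) (hFk.mono hk subset_rfl)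
    refine ⟨hne, τ, (mem_kEqualTreeTypes hk hkn).2 (hτ ▸ hFk), ?_⟩
    rw [vertexSet_eq_oneEdgeTypes, hτ]
    ext ν
    constructor
    · intro hν
      obtain ⟨B, hB, hνB⟩ := vertexSet_eq_oneEdgeTypes μ ▸ hs hν
      exact ⟨B, ⟨hB, ν, hν, hνB⟩, hνB⟩
    · rintro ⟨B, ⟨-, ν', hν', hB'⟩, hB⟩
      rwa [clusters_injective (hB.trans hB'.symm)]
  · rintro ⟨hne, τ, ⟨μ, hμ, hτ⟩, hs⟩
    exact ⟨hne, μ, hμ, hs.le.trans ((vertexSet_subset_iff (hk.trans hkn)).2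
      (isContraction_iff.1 hτ))⟩

theorem maximal_face_iff (hk : 2 ≤ k) (hkn : k < n) (s : Finset (TreeType n)) :
    Maximal (· ∈ (kEqualTreeComplex n k).faces) s ↔
      ∃ μ ∈ maximalTreeTypes n k, (s : Set (TreeType n)) = μ.vertexSet := by
  constructor
  · rintro ⟨⟨hne, μ, hμ, hs⟩, hmax⟩
    refine ⟨μ, hμ, hs.antisymm ?_⟩
    have hμs : s ⊆ μ.vertexSet.toFinite.toFinset := by simpa [← Finset.coe_subset] using hs
    have hface : μ.vertexSet.toFinite.toFinset ∈ (kEqualTreeComplex n k).faces :=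
      ⟨hne.mono hμs, μ, hμ, by simp⟩
    simpa [← Finset.coe_subset] using hmax hface hμs
  · rintro ⟨μ, hμ, hs⟩
    have hne : s.Nonempty :=
      Finset.coe_nonempty.1 (hs ▸ vertexSet_nonempty_of_mem_maximalTreeTypes hk hkn hμ)
    refine ⟨⟨hne, μ, hμ, hs.le⟩, ?_⟩
    rintro t ⟨-, μ', hμ', ht⟩ (hst : s ⊆ t)
    have hle : μ.vertexSet ⊆ μ'.vertexSet := hs ▸ (Finset.coe_subset.2 hst).trans ht
    have hge : μ'.clusters ⊆ μ.clusters :=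
      ((mem_maximalTreeTypes hk hkn.le).1 hμ).2 ((mem_maximalTreeTypes hk hkn.le).1 hμ').1
        ((vertexSet_subset_iff (hk.trans hkn.le)).1 hle)
    exact Finset.coe_subset.1
      ((ht.trans ((vertexSet_subset_iff (hk.trans hkn.le)).2 hge)).trans hs.ge)

theorem coe_subset_vertices {V : Type*} {K : PreAbstractSimplicialComplex V} {t : Finset V}
    (ht : t ∈ K.faces) : (t : Set V) ⊆ vertices K :=
  fun _ hv => (K.isRelLowerSet_faces ht).2 (Finset.singleton_subset_iff.2 hv)
    (Finset.singleton_nonempty _)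

namespace ComplexIso

variable {V W : Type*} {K : PreAbstractSimplicialComplex V} {L : PreAbstractSimplicialComplex W}

/-- The identity isomorphism. -/
def refl (K : PreAbstractSimplicialComplex V) : ComplexIso K K where
  toEquiv := Equiv.refl _
  mem_faces_iff s := by rw [Equiv.refl_toEmbedding, Finset.map_refl]

variable {φ : V → W}

open Classical in
theorem bijOn_vertices (hφ : Set.InjOn φ (vertices K))
    (h : ∀ s, s ∈ L.faces ↔ ∃ t ∈ K.faces, t.image φ = s) :
    Set.BijOn φ (vertices K) (vertices L) := by
  refine ⟨fun v hv => (h _).2 ⟨{v}, hv, Finset.image_singleton _ _⟩, hφ, fun w hw => ?_⟩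
  obtain ⟨t, ht, htw⟩ := (h _).1 hw
  obtain ⟨v, hv, hvw⟩ := Finset.mem_image.1 (htw ▸ Finset.mem_singleton_self w)
  exact ⟨v, coe_subset_vertices ht hv, hvw⟩

open Classical in
/-- The isomorphism given by a map which is injective on the vertices of `K` and for which the
simplices of `L` are the images of the simplices of `K`. -/
noncomputable def ofImage (hφ : Set.InjOn φ (vertices K))
    (h : ∀ s, s ∈ L.faces ↔ ∃ t ∈ K.faces, t.image φ = s) : ComplexIso K L where
  toEquiv := (bijOn_vertices hφ h).equiv φ
  mem_faces_iff s := by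
    set t := s.map (Function.Embedding.subtype _) with ht
    have hmap : (s.map ((bijOn_vertices hφ h).equiv φ).toEmbedding).map
        (Function.Embedding.subtype _) = t.image φ := by
      rw [ht, Finset.map_map, Finset.map_eq_image, Finset.map_eq_image, Finset.image_image]
      rfl
    have htK : (t : Set V) ⊆ vertices K := by simp [ht]
    rw [hmap, h]
    refine ⟨fun ht => ⟨t, ht, rfl⟩, ?_⟩
    rintro ⟨u, hu, hut⟩
    rw [← Finset.coe_inj, Finset.coe_image, Finset.coe_image,
      hφ.image_eq_image_iff (coe_subset_vertices hu) htK, Finset.coe_inj] at hut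
    exact hut ▸ hu

end ComplexIso

namespace KEqualLattice

theorem mem_faces_reducedNestedSetComplex_iff (hk : 2 ≤ k) (hkn : k ≤ n)
    {s : Finset (KEqualLattice n k)} :
    s ∈ (reducedNestedSetComplex (irreducibles (KEqualLattice n k))).faces ↔
      s.Nonempty ∧ ∃ F : Set (Set (Fin n)), IsTreeFamily k F ∧ block k '' F = s := by
  have top_mem_iff (F : Set (Set (Fin n))) (hF : ∀ B ∈ F, k ≤ B.ncard) (hs : block k '' F = s) :
      ⊤ ∈ s ↔ Set.univ ∈ F := by
    rw [← Finset.mem_coe, ← hs]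
    constructor
    · rintro ⟨B, hB, hB_top⟩
      rwa [← (block_eq_top_iff hk hkn (hF B hB)).1 hB_top]
    · exact fun hB => ⟨_, hB, (block_eq_top_iff hk hkn (hF _ hB)).2 rfl⟩
  constructor
  · rintro ⟨hne, hs, hs_top⟩
    obtain ⟨F, hF, hFk, hFs⟩ := (isNested_irreducibles_iff hk).1 hs
    exact ⟨hne, F, ⟨hF, hFk, mt (top_mem_iff F hFk hFs).2 hs_top⟩, hFs⟩
  · rintro ⟨hne, F, hF, hFs⟩
    exact ⟨hne, (isNested_irreducibles_iff hk).2 ⟨F, hF.laminar, hF.le_ncard, hFs⟩,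
      mt (top_mem_iff F hF.le_ncard hFs).1 hF.univ_notMem⟩

end KEqualLattice

open KEqualLattice

theorem exists_clusters_eq_singleton_of_mem_vertices (hk : 2 ≤ k) (hkn : k ≤ n) {ν : TreeType n}
    (hν : ν ∈ vertices (kEqualTreeComplex n k)) : ∃ B, k ≤ B.ncard ∧ ν.clusters = {B} := by
  obtain ⟨-, μ, hμ, hνμ⟩ := hν
  rw [Finset.coe_singleton, Set.singleton_subset_iff, vertexSet_eq_oneEdgeTypes] at hνμ
  obtain ⟨B, hB, hνB⟩ := hνμ
  exact ⟨B, ((mem_maximalTreeTypes hk hkn).1 hμ).1.le_ncard B hB, hνB⟩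

theorem vertexSet_subset_vertices {τ : TreeType n} (hτ : τ ∈ kEqualTreeTypes n k) (hn : 2 ≤ n) :
    τ.vertexSet ⊆ vertices (kEqualTreeComplex n k) := by
  obtain ⟨μ, hμ, hτ⟩ := hτ
  refine fun ν hν => ⟨Finset.singleton_nonempty ν, μ, hμ, ?_⟩
  rw [Finset.coe_singleton, Set.singleton_subset_iff]
  exact (vertexSet_subset_iff hn).2 (isContraction_iff.1 hτ) hν

theorem injOn_block_cluster (hk : 2 ≤ k) (hkn : k ≤ n) :
    Set.InjOn (fun ν : TreeType n => block k ν.cluster) (vertices (kEqualTreeComplex n k)) := by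
  intro ν hν ν' hν' h
  obtain ⟨B, hBk, hB⟩ := exists_clusters_eq_singleton_of_mem_vertices hk hkn hν
  obtain ⟨C, hCk, hC⟩ := exists_clusters_eq_singleton_of_mem_vertices hk hkn hν'
  simp only [cluster_eq_of_clusters_eq hB, cluster_eq_of_clusters_eq hC] at h
  rw [block_injOn hk hBk hCk h] at hB
  exact clusters_injective (hB.trans hC.symm)

theorem image_block_cluster_vertexSet (hn : 2 ≤ n) (τ : TreeType n) :
    (fun ν => block k ν.cluster) '' τ.vertexSet = block k '' τ.clusters := by
  rw [← Set.image_image (block k) cluster, image_cluster_vertexSet hn]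

open Classical in
theorem mem_faces_reducedNestedSetComplex_iff_exists_image (hk : 2 ≤ k) (hkn : k ≤ n)
    (s : Finset (KEqualLattice n k)) :
    s ∈ (reducedNestedSetComplex (irreducibles (KEqualLattice n k))).faces ↔
      ∃ t ∈ (kEqualTreeComplex n k).faces, t.image (fun ν => block k ν.cluster) = s := by
  rw [mem_faces_reducedNestedSetComplex_iff hk hkn]
  constructor
  · rintro ⟨hne, F, hF, hFs⟩
    obtain ⟨τ, rfl⟩ := exists_clusters_eq (hk.trans hkn) (hF.mono hk subset_rfl)
    have himage : τ.vertexSet.toFinite.toFinset.image (fun ν => block k ν.cluster) = s := by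
      rw [← Finset.coe_inj, Finset.coe_image, Set.Finite.coe_toFinset,
        image_block_cluster_vertexSet (hk.trans hkn), hFs]
    refine ⟨_, (mem_faces_kEqualTreeComplex_iff hk hkn).2 ⟨?_, τ, ?_, ?_⟩, himage⟩
    · exact Finset.image_nonempty.1 (himage ▸ hne)
    · exact (mem_kEqualTreeTypes hk hkn).2 hF
    · exact Set.Finite.coe_toFinset _
  · rintro ⟨t, ht, rfl⟩
    obtain ⟨hne, τ, hτ, htτ⟩ := (mem_faces_kEqualTreeComplex_iff hk hkn).1 ht
    refine ⟨hne.image _, τ.clusters, (mem_kEqualTreeTypes hk hkn).1 hτ, ?_⟩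
    rw [Finset.coe_image, htτ, image_block_cluster_vertexSet (hk.trans hkn)]

/-- The isomorphism of `T_{n,k}` with the reduced minimal nested set complex of `Π_{n,k}` which maps
a tree with one internal edge to the partition given by the leaves below its internal vertex. -/
noncomputable def nestedSetIso (hk : 2 ≤ k) (hkn : k ≤ n) :
    ComplexIso (kEqualTreeComplex n k)
      (reducedNestedSetComplex (irreducibles (KEqualLattice n k))) :=
  .ofImage (injOn_block_cluster hk hkn) (mem_faces_reducedNestedSetComplex_iff_exists_image hk hkn)

theorem nestedSetIso_image (hk : 2 ≤ k) (hkn : k ≤ n) (T : LabelledTree n)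
    (hT : T.type ∈ kEqualTreeTypes n k) :
    (fun v => ((nestedSetIso hk hkn).toEquiv v).1.1) '' {v | v.1 ∈ T.type.vertexSet} =
      T.nestedSet := by
  have hcoe : Subtype.val '' {v : vertices (kEqualTreeComplex n k) | v.1 ∈ T.type.vertexSet} =
      T.type.vertexSet :=
    (Subtype.image_preimage_coe _ _).trans
      (Set.inter_eq_right.2 (vertexSet_subset_vertices hT (hk.trans hkn)))
  have hval : ∀ ν ∈ T.type.vertexSet, (block k ν.cluster).1 = blockPartition ν.cluster := by
    intro ν hν
    refine block_val hk (((mem_kEqualTreeTypes hk hkn).1 hT).le_ncard _ ?_)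
    exact image_cluster_vertexSet (hk.trans hkn) T.type ▸ Set.mem_image_of_mem cluster hν
  calc (fun v => ((nestedSetIso hk hkn).toEquiv v).1.1) '' {v | v.1 ∈ T.type.vertexSet}
      = (fun ν => blockPartition ν.cluster) '' (Subtype.val ''
          {v : vertices (kEqualTreeComplex n k) | v.1 ∈ T.type.vertexSet}) := by
        rw [Set.image_image]
        exact Set.image_congr fun v hv => hval v.1 hv
    _ = blockPartition '' T.type.clusters := by
        rw [hcoe, ← Set.image_image blockPartition cluster, image_cluster_vertexSet (hk.trans hkn)]
    _ = T.nestedSet := T.nestedSet_eq_image.symm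

end TreeComplex

theorem mainTheorem7 (n k : ℕ) (hk : 2 ≤ k) (hkn : k < n) :
    -- the simplices of `T_{n,k}` are given by the combinatorial types of `k`-equal trees
    -- with at least one internal edge, ordered by contraction of internal edges,
    -- and the maximal simplices by the types that are binary except at `k`-ary preleaves
    ((∀ s : Finset (TreeType n), s ∈ (kEqualTreeComplex n k).faces ↔
        s.Nonempty ∧ ∃ τ ∈ kEqualTreeTypes n k, (s : Set (TreeType n)) = τ.vertexSet) ∧
      Set.InjOn TreeType.vertexSet (kEqualTreeTypes n k) ∧
      (∀ σ ∈ kEqualTreeTypes n k, ∀ τ ∈ kEqualTreeTypes n k,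
        σ.vertexSet ⊆ τ.vertexSet ↔ τ.IsContraction σ) ∧
      (∀ s : Finset (TreeType n), Maximal (· ∈ (kEqualTreeComplex n k).faces) s ↔
        ∃ μ ∈ maximalTreeTypes n k, (s : Set (TreeType n)) = μ.vertexSet)) ∧
    -- `T_{n,k}` and the reduced minimal nested set complex coincide, where a tree is identified
    -- with the nested set given by the leaf sets below its internal vertices
    (∃ e : ComplexIso (kEqualTreeComplex n k)
        (reducedNestedSetComplex (irreducibles (KEqualLattice n k))),
      ∀ T : LabelledTree n, T.type ∈ kEqualTreeTypes n k →
        (fun v => (e.toEquiv v).1.1) '' {v | v.1 ∈ T.type.vertexSet} = T.nestedSet) ∧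
    -- the order complex is obtained from `T_{n,k}` by stellar subdivisions
    ObtainedByStellarSubdivisions (kEqualTreeComplex n k) (orderComplex (KEqualLattice n k)) := by
  have hn : 2 ≤ n := hk.trans hkn.le
  have vertexSet_subset_iff_isContraction (σ τ : TreeType n) :
      σ.vertexSet ⊆ τ.vertexSet ↔ τ.IsContraction σ := by
    rw [TreeType.vertexSet_subset_iff hn, TreeType.isContraction_iff]
  refine ⟨⟨fun s => mem_faces_kEqualTreeComplex_iff hk hkn.le,
      (TreeType.vertexSet_injective hn).injOn,
      fun σ _ τ _ => vertexSet_subset_iff_isContraction σ τ,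
      maximal_face_iff hk hkn⟩,
    ⟨nestedSetIso hk hkn.le, nestedSetIso_image hk hkn.le⟩,
    ⟨KEqualLattice n k, _, _, ⟨nestedSetIso hk hkn.le⟩,
      KEqualLattice.reflTransGen_orderComplex hk hkn.le, ⟨ComplexIso.refl _⟩⟩⟩
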